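/- Consider the sparse quadratically constrained quadratic program $$\min_{x\in\mathbb R^n} f_0(x)\quad\text{s.t.}\quad f_i(x)\le 0\ (i=1,\dots,k),\quad Ax-b\le 0,\quad \|x\|_0\le s,\quad x\in X_1\times\cdots\times X_n,$$ where $f_i(x)=\tfrac12 x^\top Q_i x+q_i^\top x+c_i$ with $Q_i$ symmetric ($i=0,\dots,k$), $A\in\mathbb R^{m\times n}$ has rows $a_1^\top,\dots,a_m^\top$, and each $X_i\ni 0$ is a closed interval of $\mathbb R$. Write $\mathbb S=\{x:\|x\|_0\le s\}$, $X_T=\prod_{i\in T}X_i$, $x_T$ for the subvector indexed by $T$, $\overline T=\{1,\dots,n\}\setminus T$, $\Pi_\Omega$ for the metric projection onto $\Omega$ (where $z=\Pi_\Omega(v)$ means that $z$ is the unique nearest point of $\Omega$ to $v$), $L(x,\mu,\lambda)=f_0(x)+\sum_{i=1}^k\mu_if_i(x)+\langle\lambda,Ax-b\rangle$, $\phi(a,b)=\sqrt{a^2+b^2}-a-b$, and $Y=(x,\nu,\mu,\lambda)\in\mathbb R^n\times\mathbb R^n\times\mathbb R^k\times\mathbb R^m$ with the Euclidean norm. For $\tau>0$,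 $T\subseteq\{1,\dots,n\}$ and $Y=(x,\nu,\mu,\lambda)$ let $$\mathbb T_\tau(Y)=\{T\subseteq\{1,\dots,n\}:|T|=s,\ |u_i|\ge|u_j|\ \forall i\in T,\ j\in\overline T\},\qquad u=x-\tau(\nabla_xL(x,\mu,\lambda)+\nu),$$ $$F(Y;T)=\Big((\nabla_xL(x,\mu,\lambda)+\nu)_T;\ x_{\overline T};\ x_T-\Pi_{X_T}(x_T+\nu_T);\ \nu_{\overline T};\ \big(\phi(-f_i(x),\mu_i)\big)_{i\le k};\ \big(\phi(b_i-\langle a_i,x\rangle,\lambda_i)\big)_{i\le m}\Big),$$ and let $\partial F(Y;T)$ be the Clarke generalized Jacobian of $F(\cdot;T)$ at $Y$, i.e. the convex hull of all limits of Jacobians of $F(\cdot;T)$ at points of differentiability converging to $Y$. Let $\tau>0$ and let $x^*$ be a P-stationary point with constant $\tau$ and multipliers $(\nu^*,\mu^*,\lambda^*)$; that is, with $\Gamma_*=\operatorname{supp}(x^*)$, $g^*=\nabla_xL(x^*,\mu^*,\lambda^*)$, $$x^*=\Pi_{\mathbb S}\big(x^*-\tau(g^*+\nu^*)\big),\quad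 x^*_{\Gamma_*}=\Pi_{X_{\Gamma_*}}(x^*_{\Gamma_*}+\nu^*_{\Gamma_*}),\quad \nu^*_{\overline\Gamma_*}=0,$$ $$f_i(x^*)\le0,\ \mu_i^*\ge0,\ \mu_i^*f_i(x^*)=0\ (i\le k),\qquad Ax^*-b\le0,\ \lambda^*\ge0,\ \langle\lambda^*,Ax^*-b\rangle=0 .$$ Put $Y^*=(x^*,\nu^*,\mu^*,\lambda^*)$ and assume: (i) (restricted LICQ) $x^*$ is feasible and, for every $T\supseteq\Gamma_*$ with $|T|=s$, the family consisting of $(\nabla f_i(x^*))_{\Gamma_*}$ for $1\le i\le k$ with $f_i(x^*)=0$, of $(a_i)_{\Gamma_*}$ for $i\le m$ with $\langle a_i,x^*\rangle=b_i$, and of $(e_i)_{\Gamma_*}$ for $i\in T$ with $x_i^*\in\operatorname{bd}(X_i)$, is linearly independent; (ii) for every $T\in\mathbb T_\tau(Y^*)$, $\langle d,\nabla^2_{xx}L(x^*,\mu^*,\lambda^*)d\rangle>0$ for every nonzero $d\in\mathbb R^n$ such that $\langle\nabla f_i(x^*),d\rangle=0$ whenever $1\le i\le k$, $\mu_i^*>0$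 and $f_i(x^*)=0$; $\langle a_i,d\rangle=0$ whenever $i\le m$, $\lambda_i^*>0$ and $\langle a_i,x^*\rangle=b_i$; and $d_i=0$ whenever $i\in T$, $\nu_i^*\neq0$ and $x_i^*\in\operatorname{bd}(X_i)$. Then for every $\varepsilon\in(0,1)$ there is a neighbourhood $N$ of $Y^*$ such that for every $Y=(x,\nu,\mu,\lambda)\in N$ with $\|x\|_0\le s$, every $T\in\mathbb T_\tau(Y)$ and every $W\in\partial F(Y;T)$, the matrix $W$ is nonsingular and the Newton point $Z=Y-W^{-1}F(Y;T)$ satisfies $$\|F(Z;T)\|\le\varepsilon\,\|F(Y;T)\|.$$ -/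

import Mathlib

open Set Filter Topology
open scoped Matrix

noncomputable section

/-- The metric projection of `v` onto `Ω`, as the set of all nearest points:
`argmin_{z ∈ Ω} ‖z - v‖`. -/
def nearestPoints {E : Type*} [NormedAddCommGroup E] (Ω : Set E) (v : E) : Set E :=
  {z | z ∈ Ω ∧ ∀ w ∈ Ω, ‖z - v‖ ≤ ‖w - v‖}

/-- The metric projection as a point, for sets `Ω` on which it is single valued
(see `SQCQP.nearestPoints_box` for the boxes to which it is applied). -/
def projPoint {E : Type*} [NormedAddCommGroup E] (Ω : Set E) (v : E) : E :=
  open Classical in if h : (nearestPoints Ω v).Nonempty then h.some else 0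

/-- The Clarke generalized Jacobian: the convex hull of all limits of derivatives
`f'(x_ℓ)` along sequences of points of differentiability `x_ℓ → x`. -/
def clarkeJacobian {E G : Type*} [NormedAddCommGroup E] [NormedSpace ℝ E]
    [NormedAddCommGroup G] [NormedSpace ℝ G] (f : E → G) (x : E) : Set (E →L[ℝ] G) :=
  convexHull ℝ {W | ∃ u : ℕ → E, (∀ l, DifferentiableAt ℝ f (u l)) ∧
    Tendsto u atTop (𝓝 x) ∧ Tendsto (fun l => fderiv ℝ f (u l)) atTop (𝓝 W)}

/-- The Fischer-Burmeister function. -/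
def fischerBurmeister (a b : ℝ) : ℝ := Real.sqrt (a ^ 2 + b ^ 2) - a - b

/-- The subvector `x_T`. -/
def subvec {n : ℕ} (T : Finset (Fin n)) (x : EuclideanSpace ℝ (Fin n)) : EuclideanSpace ℝ T :=
  WithLp.toLp 2 fun i => x i

/-- The support of a vector. -/
def supp {n : ℕ} (x : EuclideanSpace ℝ (Fin n)) : Finset (Fin n) :=
  Finset.univ.filter fun i => x i ≠ 0

/-- The stacked vectors `Y = (x, ν, μ, lam)` of `ℝⁿ × ℝⁿ × ℝᵏ × ℝᵐ` with the Euclidean norm. -/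
abbrev PrimalDual (n k m : ℕ) : Type := EuclideanSpace ℝ (Fin n ⊕ Fin n ⊕ Fin k ⊕ Fin m)

namespace PrimalDual

variable {n k m : ℕ}

/-- The block `x` of `Y = (x, ν, μ, lam)`. -/
def x (Y : PrimalDual n k m) : EuclideanSpace ℝ (Fin n) :=
  WithLp.toLp 2 fun i => Y (Sum.inl i)

/-- The block `ν` of `Y = (x, ν, μ, lam)`. -/
def ν (Y : PrimalDual n k m) : EuclideanSpace ℝ (Fin n) :=
  WithLp.toLp 2 fun i => Y (Sum.inr (Sum.inl i))

/-- The block `μ` of `Y = (x, ν, μ, lam)`. -/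
def μ (Y : PrimalDual n k m) : EuclideanSpace ℝ (Fin k) :=
  WithLp.toLp 2 fun i => Y (Sum.inr (Sum.inr (Sum.inl i)))

/-- The block `lam` of `Y = (x, ν, μ, lam)`. -/
def lam (Y : PrimalDual n k m) : EuclideanSpace ℝ (Fin m) :=
  WithLp.toLp 2 fun i => Y (Sum.inr (Sum.inr (Sum.inr i)))

end PrimalDual

/-- The data of a sparse quadratically constrained quadratic program in `n` variables with `k`
quadratic and `m` linear inequality constraints, sparsity level `s` and the box
`X 1 × ⋯ × X n` of closed intervals containing `0`. Index `0` of `Q`, `q`, `c` is the objective,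
index `i.succ` is the `i`-th quadratic constraint. -/
structure SQCQP (n k m : ℕ) where
  Q : Fin (k + 1) → Matrix (Fin n) (Fin n) ℝ
  Q_symm : ∀ i, (Q i).IsSymm
  q : Fin (k + 1) → EuclideanSpace ℝ (Fin n)
  c : Fin (k + 1) → ℝ
  A : Matrix (Fin m) (Fin n) ℝ
  b : EuclideanSpace ℝ (Fin m)
  s : ℕ
  X : Fin n → Set ℝ
  X_closed : ∀ i, IsClosed (X i)
  X_interval : ∀ i, (X i).OrdConnected
  X_zero : ∀ i, (0 : ℝ) ∈ X i

namespace SQCQP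

variable {n k m : ℕ} (P : SQCQP n k m)

/-- The quadratic functions `f_i(x) = ½ xᵀ Q_i x + q_iᵀ x + c_i`. -/
def f (i : Fin (k + 1)) (x : EuclideanSpace ℝ (Fin n)) : ℝ :=
  1 / 2 * (x.ofLp ⬝ᵥ (P.Q i *ᵥ x.ofLp)) + (P.q i).ofLp ⬝ᵥ x.ofLp + P.c i

/-- The `i`-th row of `A`, as a column vector. -/
def a (i : Fin m) : EuclideanSpace ℝ (Fin n) := WithLp.toLp 2 (P.A i)

/-- The set `F` given by the quadratic and the linear inequality constraints. -/
def constraintSet : Set (EuclideanSpace ℝ (Fin n)) :=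
  {x | (∀ i : Fin k, P.f i.succ x ≤ 0) ∧ ∀ i : Fin m, inner ℝ (P.a i) x ≤ P.b i}

/-- The sparse set `S = {x : ‖x‖₀ ≤ s}`. -/
def sparseSet : Set (EuclideanSpace ℝ (Fin n)) := {x | (supp x).card ≤ P.s}

/-- The box `X_T = ∏_{i ∈ T} X_i`, a subset of `ℝ^T`. -/
def box (T : Finset (Fin n)) : Set (EuclideanSpace ℝ T) := {z | ∀ i : T, z i ∈ P.X i}

/-- The collection `J_s(x)` of index sets of size `s` that contain the support of `x`. -/
def supportSets (x : EuclideanSpace ℝ (Fin n)) : Set (Finset (Fin n)) :=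
  {J | J.card = P.s ∧ supp x ⊆ J}

/-- The Lagrangian `L(x, μ, lam) = f_0(x) + ∑ μ_i f_i(x) + ⟨lam, A x - b⟩`. -/
def lagrangian (x : EuclideanSpace ℝ (Fin n)) (μ : EuclideanSpace ℝ (Fin k))
    (lam : EuclideanSpace ℝ (Fin m)) : ℝ :=
  P.f 0 x + ∑ i : Fin k, μ i * P.f i.succ x + ∑ i : Fin m, lam i * (inner ℝ (P.a i) x - P.b i)

/-- The gradient `∇_x L(x, μ, lam)` at the point `Y = (x, ν, μ, lam)`. -/
def gradL (Y : PrimalDual n k m) : EuclideanSpace ℝ (Fin n) :=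
  gradient (fun z => P.lagrangian z Y.μ Y.lam) Y.x

/-- The Hessian `∇²_xx L(x, μ, lam)` at the point `Y = (x, ν, μ, lam)`, as a linear map. -/
def hessL (Y : PrimalDual n k m) : EuclideanSpace ℝ (Fin n) →L[ℝ] EuclideanSpace ℝ (Fin n) :=
  fderiv ℝ (fun y => gradient (fun z => P.lagrangian z Y.μ Y.lam) y) Y.x

/-- The system saying that `x` is a P-stationary point with constant `τ` and multipliers
`(ν, μ, lam)`, where `Y = (x, ν, μ, lam)`. Equality with a projection means that the given
point is the only nearest point. -/
def IsPStationary (τ : ℝ) (Y : PrimalDual n k m) : Prop :=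
  nearestPoints P.sparseSet (Y.x - τ • (P.gradL Y + Y.ν)) = {Y.x} ∧
  nearestPoints (P.box (supp Y.x)) (subvec (supp Y.x) Y.x + subvec (supp Y.x) Y.ν) =
    {subvec (supp Y.x) Y.x} ∧
  (∀ i, i ∉ supp Y.x → Y.ν i = 0) ∧
  (∀ i : Fin k, P.f i.succ Y.x ≤ 0 ∧ 0 ≤ Y.μ i ∧ Y.μ i * P.f i.succ Y.x = 0) ∧
  (∀ i : Fin m, inner ℝ (P.a i) Y.x - P.b i ≤ 0) ∧ (∀ i : Fin m, 0 ≤ Y.lam i) ∧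
  ∑ i : Fin m, Y.lam i * (inner ℝ (P.a i) Y.x - P.b i) = 0

/-- The collection `T_τ(Y)` of sets of `s` indices of largest absolute entries of
`u = x - τ (∇_x L(x, μ, lam) + ν)`. -/
def largestSets (τ : ℝ) (Y : PrimalDual n k m) : Set (Finset (Fin n)) :=
  {T | T.card = P.s ∧ ∀ i ∈ T, ∀ j ∉ T,
    |(Y.x - τ • (P.gradL Y + Y.ν)) j| ≤ |(Y.x - τ • (P.gradL Y + Y.ν)) i|}

/-- The stationary function `F(Y; T)`: the six stacked blocks
`(∇_x L + ν)_T`, `x_{Tᶜ}`, `x_T - Π_{X_T}(x_T + ν_T)`, `ν_{Tᶜ}`, `φ(-f_i(x), μ_i)`,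
`φ(b_i - ⟨a_i, x⟩, lam_i)`. -/
def F (T : Finset (Fin n)) (Y : PrimalDual n k m) :
    EuclideanSpace ℝ (T ⊕ ↥(Tᶜ) ⊕ T ⊕ ↥(Tᶜ) ⊕ Fin k ⊕ Fin m) :=
  WithLp.toLp 2
    (Sum.elim (subvec T (P.gradL Y + Y.ν)).ofLp
    (Sum.elim (subvec Tᶜ Y.x).ofLp
    (Sum.elim (subvec T Y.x - projPoint (P.box T) (subvec T Y.x + subvec T Y.ν)).ofLp
    (Sum.elim (subvec Tᶜ Y.ν).ofLp
    (Sum.elim (fun i : Fin k => fischerBurmeister (-P.f i.succ Y.x) (Y.μ i))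
      (fun i : Fin m => fischerBurmeister (P.b i - inner ℝ (P.a i) Y.x) (Y.lam i)))))))

/-- The restricted LICQ at `x`: `x` is feasible, and for every `T ∈ J_s(x)` the family formed by
the restrictions to `supp x` of the gradients of the active quadratic constraints, of the active
rows of `A`, and of the unit vectors `e_i` with `i ∈ T` and `x_i ∈ bd (X_i)`
is linearly independent. -/
def RestrictedLICQ (x : EuclideanSpace ℝ (Fin n)) : Prop :=
  (x ∈ P.constraintSet ∧ x ∈ P.sparseSet ∧ ∀ i, x i ∈ P.X i) ∧
  ∀ T ∈ P.supportSets x,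
    LinearIndependent ℝ
      (Sum.elim (fun i : {i : Fin k // P.f i.succ x = 0} =>
          subvec (supp x) (gradient (P.f i.1.succ) x))
        (Sum.elim (fun i : {i : Fin m // inner ℝ (P.a i) x = P.b i} => subvec (supp x) (P.a i.1))
          (fun i : {i : Fin n // i ∈ T ∧ x i ∈ frontier (P.X i)} =>
            subvec (supp x) (EuclideanSpace.single i.1 (1 : ℝ)))))

/-- The cone `Q(Y; T)` of directions annihilated by the strongly active constraints. -/
def coneQ (Y : PrimalDual n k m) (T : Finset (Fin n)) : Set (EuclideanSpace ℝ (Fin n)) :=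
  {d | (∀ i : Fin k, 0 < Y.μ i → P.f i.succ Y.x = 0 → inner ℝ (gradient (P.f i.succ) Y.x) d = 0) ∧
    (∀ i : Fin m, 0 < Y.lam i → inner ℝ (P.a i) Y.x = P.b i → inner ℝ (P.a i) d = 0) ∧
    (∀ i ∈ T, Y.ν i ≠ 0 → Y.x i ∈ frontier (P.X i) → d i = 0)}

/-- The second-order condition: the Hessian of the Lagrangian is positive on the nonzero
vectors of `Q(Y; T)`. -/
def StrongSecondOrder (Y : PrimalDual n k m) (T : Finset (Fin n)) : Prop :=
  ∀ d ∈ P.coneQ Y T, d ≠ 0 → 0 < inner ℝ d (P.hessL Y d)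

/-- The projection onto `X_T` is single valued and is given by `projPoint`. -/
theorem nearestPoints_box (T : Finset (Fin n)) (v : EuclideanSpace ℝ T) :
    nearestPoints (P.box T) v = {projPoint (P.box T) v} := by
  have hcl : IsClosed (P.box T) := by
    have : P.box T = ⋂ i : T, (fun z : EuclideanSpace ℝ T => z i) ⁻¹' P.X i := by
      ext z; simp [box]
    rw [this]
    exact isClosed_iInter fun i => (P.X_closed i).preimage (by fun_prop)
  have hne : (P.box T).Nonempty := ⟨0, fun i => by simpa using P.X_zero i⟩
  have hcv : Convex ℝ (P.box T) := by
    intro y hy z hz a b ha hb hab i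
    exact (P.X_interval i).convex (hy i) (hz i) ha hb hab
  have hex : (nearestPoints (P.box T) v).Nonempty := by
    obtain ⟨z, hz, hd⟩ := hcl.exists_infDist_eq_dist hne v
    refine ⟨z, hz, fun w hw => ?_⟩
    have := Metric.infDist_le_dist_of_mem (x := v) hw
    rw [hd] at this
    rwa [dist_comm, dist_eq_norm, dist_comm, dist_eq_norm] at this
  have hmem : projPoint (P.box T) v ∈ nearestPoints (P.box T) v := by
    unfold projPoint; rw [dif_pos hex]; exact hex.some_mem
  refine Set.eq_singleton_iff_unique_mem.2 ⟨hmem, fun z hz => ?_⟩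
  set y := projPoint (P.box T) v
  have hmid : (1 / 2 : ℝ) • z + (1 / 2 : ℝ) • y ∈ P.box T :=
    hcv hz.1 hmem.1 (by norm_num) (by norm_num) (by norm_num)
  have h1 := hz.2 _ hmid
  have h2 : ‖z - v‖ = ‖y - v‖ := le_antisymm (hz.2 _ hmem.1) (hmem.2 _ hz.1)
  have h3 := parallelogram_law_with_norm ℝ (z - v) (y - v)
  have h4 : (1 / 2 : ℝ) • z + (1 / 2 : ℝ) • y - v = (1 / 2 : ℝ) • ((z - v) + (y - v)) := by
    module
  rw [h4, norm_smul] at h1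
  norm_num at h1
  rw [← h2] at h3
  have h5 : (z - v) - (y - v) = z - y := by abel
  rw [h5] at h3
  have h6 : ‖z - y‖ = 0 := by
    nlinarith [norm_nonneg (z - y), norm_nonneg (z - v), norm_nonneg ((z - v) + (y - v))]
  exact sub_eq_zero.1 (norm_eq_zero.1 h6)

end SQCQP

end

/-!
Fix an index set `T`. The map `F(·; T)` is smooth except for two kinds of scalar pieces: the
projection onto an interval and the Fischer–Burmeister function `√(a² + b²) - a - b`. Both are
semismooth, and their Clarke subdifferentials lie in explicit closed convex sets
(`intervalSlopes`, `normSlopes`). Replacing the derivatives of these pieces by admissible slopes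
`θ` turns the Jacobian of `F(·; T)` at `Y` into an operator `SQCQP.jac`, jointly continuous in
`(Y, θ)` and affine in `θ`; hence the Clarke Jacobian at `Y` is contained in the set of all
`jac T Y θ` with `θ` admissible at `Y` (`SQCQP.clarkeJacobian_F_subset`). The rest of the argument
works with this larger set.

* Sets of `s` largest entries at points near `Y*` are also such sets at `Y*`
  (`SQCQP.eventually_largestSets_subset`), and for these uniqueness of the sparse projection gives
  `supp x* ⊆ T` and `F(Y*; T) = 0` (`SQCQP.IsPStationary.F_eq_zero`).
* Every admissible operator at `Y*` is injective (`SQCQP.IsPStationary.injective_jac`): in its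
  kernel the products of primal and multiplier directions are nonnegative, so the second-order
  condition kills the `x`-part and the restricted LICQ the multipliers. Admissible slopes range in
  a compact set and form a closed relation, so the operators stay uniformly nonsingular and bounded
  near `Y*` (`exists_eventually_bounds`).
* For admissible `θ` at `Y`, `F(Y; T) - F(Y*; T) - jac T Y θ (Y - Y*) = o(‖Y - Y*‖)`
  (`SQCQP.eventually_norm_F_sub_le`).

Then the Newton point `Z` satisfies `‖Z - Y*‖ = o(‖Y - Y*‖)`, while `‖F(Z; T)‖ = O(‖Z - Y*‖)` and
`‖Y - Y*‖ = O(‖F(Y; T)‖)` (`eventually_norm_newton_le`). There are finitely many `T`, so one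
neighbourhood serves them all.
-/

/-! ### Projection onto a closed interval -/

/-- Variational inequality for a nearest point of an interval. -/
theorem mul_nonpos_of_mem_nearestPoints {X : Set ℝ} (hX : X.OrdConnected) {w p y : ℝ}
    (hp : p ∈ nearestPoints X w) (hy : y ∈ X) : (w - p) * (y - p) ≤ 0 := by
  by_contra! h
  rcases pos_and_pos_or_neg_and_neg_of_mul_pos h with ⟨h1, h2⟩ | ⟨h1, h2⟩
  · have hz : min y w ∈ X := hX.out hp.1 hy ⟨by rw [le_min_iff]; constructor <;> linarith,
      min_le_left _ _⟩
    have h3 := hp.2 _ hz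
    have h4 : p < min y w := by rw [lt_min_iff]; constructor <;> linarith
    have h5 : min y w ≤ w := min_le_right _ _
    rw [Real.norm_eq_abs, Real.norm_eq_abs, abs_of_neg (by linarith),
      abs_of_nonpos (by linarith)] at h3
    linarith
  · have hz : max y w ∈ X := hX.out hy hp.1 ⟨le_max_left _ _,
      by rw [max_le_iff]; constructor <;> linarith⟩
    have h3 := hp.2 _ hz
    have h4 : max y w < p := by rw [max_lt_iff]; constructor <;> linarith
    have h5 : w ≤ max y w := le_max_right _ _
    rw [Real.norm_eq_abs, Real.norm_eq_abs, abs_of_pos (by linarith),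
      abs_of_nonneg (by linarith)] at h3
    linarith

theorem eq_of_mem_nearestPoints {X : Set ℝ} (hX : X.OrdConnected) {w p p' : ℝ}
    (hp : p ∈ nearestPoints X w) (hp' : p' ∈ nearestPoints X w) : p = p' := by
  have h1 := mul_nonpos_of_mem_nearestPoints hX hp hp'.1
  have h2 := mul_nonpos_of_mem_nearestPoints hX hp' hp.1
  nlinarith [sq_nonneg (p - p')]

theorem eq_of_mem_nearestPoints_of_mem {X : Set ℝ} {w p : ℝ}
    (hp : p ∈ nearestPoints X w) (hw : w ∈ X) : p = w := by
  have := hp.2 w hw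
  rw [sub_self, norm_zero] at this
  exact sub_eq_zero.1 (norm_le_zero_iff.1 this)

/-- Only an interior point itself projects to it. -/
theorem eq_of_mem_nearestPoints_of_mem_interior {X : Set ℝ} (hX : X.OrdConnected) {w p : ℝ}
    (hp : p ∈ nearestPoints X w) (hpi : p ∈ interior X) : w = p := by
  obtain ⟨r, hr, hball⟩ := Metric.isOpen_iff.1 isOpen_interior p hpi
  have h1 := mul_nonpos_of_mem_nearestPoints hX hp (y := p + r / 2)
    (interior_subset (hball (by
      rw [Metric.mem_ball, Real.dist_eq, add_sub_cancel_left, abs_of_pos] <;> linarith)))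
  have h2 := mul_nonpos_of_mem_nearestPoints hX hp (y := p - r / 2)
    (interior_subset (hball (by
      rw [Metric.mem_ball, Real.dist_eq, abs_sub_comm, sub_sub_cancel, abs_of_pos] <;> linarith)))
  nlinarith

theorem projPoint_mem_nearestPoints {X : Set ℝ} (hc : IsClosed X) (hne : X.Nonempty) (w : ℝ) :
    projPoint X w ∈ nearestPoints X w := by
  have hex : (nearestPoints X w).Nonempty := by
    obtain ⟨z, hz, hd⟩ := hc.exists_infDist_eq_dist hne w
    refine ⟨z, hz, fun y hy => ?_⟩
    have := Metric.infDist_le_dist_of_mem (x := w) hy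
    rw [hd] at this
    rwa [dist_comm, dist_eq_norm, dist_comm, dist_eq_norm] at this
  unfold projPoint
  rw [dif_pos hex]
  exact hex.some_mem

/-- An outer estimate of the Clarke subdifferential at `w` of the projection onto the interval
`X`; it is exact unless `X` is a single point. -/
def intervalSlopes (X : Set ℝ) (w : ℝ) : Set ℝ :=
  {t | t ∈ Icc (0 : ℝ) 1 ∧ (w ∈ interior X → t = 1) ∧ (w ∉ X → t = 0)}

theorem intervalSlopes_nonempty (X : Set ℝ) (w : ℝ) : (intervalSlopes X w).Nonempty := by
  by_cases h : w ∈ X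
  · exact ⟨1, by norm_num, fun _ => rfl, fun h' => absurd h h'⟩
  · exact ⟨0, by norm_num, fun h' => absurd (interior_subset h') h, fun _ => rfl⟩

theorem convex_intervalSlopes (X : Set ℝ) (w : ℝ) : Convex ℝ (intervalSlopes X w) := by
  rintro t ⟨ht, ht1, ht0⟩ t' ⟨ht', ht1', ht0'⟩ α β hα hβ hαβ
  refine ⟨convex_Icc 0 1 ht ht' hα hβ hαβ, fun h => ?_, fun h => ?_⟩
  · simp [ht1 h, ht1' h, hαβ]
  · simp [ht0 h, ht0' h]

theorem isClosed_graph_intervalSlopes {X : Set ℝ} (hc : IsClosed X) :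
    IsClosed {q : ℝ × ℝ | q.2 ∈ intervalSlopes X q.1} := by
  have h : {q : ℝ × ℝ | q.2 ∈ intervalSlopes X q.1} =
      (Prod.snd ⁻¹' Icc 0 1) ∩ ((Prod.fst ⁻¹' (interior X)ᶜ ∪ Prod.snd ⁻¹' {1}) ∩
        (Prod.fst ⁻¹' X ∪ Prod.snd ⁻¹' {0})) := by
    ext q
    simp only [intervalSlopes, mem_ofPred_eq, mem_inter_iff, mem_union, mem_preimage,
      mem_compl_iff, mem_singleton_iff]
    tauto
  rw [h]
  exact (isClosed_Icc.preimage continuous_snd).inter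
    (((isOpen_interior.isClosed_compl.preimage continuous_fst).union
      (isClosed_singleton.preimage continuous_snd)).inter
    ((hc.preimage continuous_fst).union (isClosed_singleton.preimage continuous_snd)))

/-- Firm nonexpansiveness of the projection onto an interval. -/
theorem sq_projPoint_sub_le {X : Set ℝ} (hc : IsClosed X) (hX : X.OrdConnected)
    (hne : X.Nonempty) (w w' : ℝ) :
    (projPoint X w - projPoint X w') ^ 2 ≤ (w - w') * (projPoint X w - projPoint X w') := by
  have hp := projPoint_mem_nearestPoints hc hne w
  have hp' := projPoint_mem_nearestPoints hc hne w'
  have h1 := mul_nonpos_of_mem_nearestPoints hX hp hp'.1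
  have h2 := mul_nonpos_of_mem_nearestPoints hX hp' hp.1
  nlinarith

theorem monotone_projPoint {X : Set ℝ} (hc : IsClosed X) (hX : X.OrdConnected)
    (hne : X.Nonempty) : Monotone (projPoint X) := by
  intro w w' h
  have := sq_projPoint_sub_le hc hX hne w w'
  by_contra! hlt
  nlinarith

theorem monotone_id_sub_projPoint {X : Set ℝ} (hc : IsClosed X) (hX : X.OrdConnected)
    (hne : X.Nonempty) : Monotone (fun w => w - projPoint X w) := by
  intro w w' h
  have := sq_projPoint_sub_le hc hX hne w w'
  have hm := monotone_projPoint hc hX hne h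
  rcases hm.eq_or_lt with he | hlt
  · simp only; linarith
  · simp only
    by_contra! hlt'
    nlinarith

/-- The projection onto an interval is piecewise affine with slopes in `intervalSlopes`, so the
linearisation taken at a point `w` near `w₀` is exact at `w₀`. -/
theorem eventually_projPoint_sub_eq {X : Set ℝ} (hc : IsClosed X) (hX : X.OrdConnected)
    (hne : X.Nonempty) (w₀ : ℝ) :
    ∀ᶠ w in 𝓝 w₀, ∀ t ∈ intervalSlopes X w, projPoint X w - projPoint X w₀ = t * (w - w₀) := by
  have hp₀ := projPoint_mem_nearestPoints hc hne w₀
  have key : ∀ w, projPoint X w ∈ nearestPoints X w := projPoint_mem_nearestPoints hc hne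
  by_cases hw₀ : w₀ ∈ X
  · have hp : projPoint X w₀ = w₀ := eq_of_mem_nearestPoints_of_mem hp₀ hw₀
    -- on each side of `w₀` either `X` contains a one-sided neighbourhood or it has no points
    have hr : ∀ᶠ w in 𝓝 w₀, w₀ < w → w ∈ interior X ∨ (w ∉ X ∧ projPoint X w = w₀) := by
      by_cases h : ∃ y ∈ X, w₀ < y
      · obtain ⟨y, hy, hlt⟩ := h
        filter_upwards [eventually_lt_nhds hlt] with w hw hw'
        exact Or.inl (mem_interior.2 ⟨Ioo w₀ y, fun z hz => hX.out hw₀ hy ⟨hz.1.le, hz.2.le⟩,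
          isOpen_Ioo, hw', hw⟩)
      · push Not at h
        refine Eventually.of_forall fun w hw => Or.inr ⟨fun hwX => (h w hwX).not_gt hw, ?_⟩
        have h1 := mul_nonpos_of_mem_nearestPoints hX (key w) hw₀
        have h2 := h _ (key w).1
        nlinarith
    have hl : ∀ᶠ w in 𝓝 w₀, w < w₀ → w ∈ interior X ∨ (w ∉ X ∧ projPoint X w = w₀) := by
      by_cases h : ∃ y ∈ X, y < w₀
      · obtain ⟨y, hy, hlt⟩ := h
        filter_upwards [eventually_gt_nhds hlt] with w hw hw'
        exact Or.inl (mem_interior.2 ⟨Ioo y w₀, fun z hz => hX.out hy hw₀ ⟨hz.1.le, hz.2.le⟩,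
          isOpen_Ioo, hw, hw'⟩)
      · push Not at h
        refine Eventually.of_forall fun w hw => Or.inr ⟨fun hwX => (h w hwX).not_gt hw, ?_⟩
        have h1 := mul_nonpos_of_mem_nearestPoints hX (key w) hw₀
        have h2 := h _ (key w).1
        nlinarith
    filter_upwards [hr, hl] with w hr hl t ht
    rcases eq_or_ne w w₀ with rfl | hne'
    · simp
    have h3 : w ∈ interior X ∨ (w ∉ X ∧ projPoint X w = w₀) :=
      hne'.lt_or_gt.elim hl hr
    rcases h3 with h3 | ⟨h3, h4⟩
    · rw [hp, eq_of_mem_nearestPoints_of_mem (key w) (interior_subset h3), ht.2.1 h3, one_mul]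
    · rw [hp, h4, ht.2.2 h3]; ring
  · have hne' : projPoint X w₀ ≠ w₀ := fun h => hw₀ (h ▸ hp₀.1)
    have hloc : ∀ᶠ w in 𝓝 w₀, projPoint X w = projPoint X w₀ := by
      rcases hne'.lt_or_gt with hlt | hlt
      · filter_upwards [eventually_gt_nhds hlt] with w hw
        have h1 := mul_nonpos_of_mem_nearestPoints hX (key w) hp₀.1
        have h2 := mul_nonpos_of_mem_nearestPoints hX hp₀ (key w).1
        have h3 : projPoint X w ≤ projPoint X w₀ := by nlinarith
        nlinarith
      · filter_upwards [eventually_lt_nhds hlt] with w hw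
        have h1 := mul_nonpos_of_mem_nearestPoints hX (key w) hp₀.1
        have h2 := mul_nonpos_of_mem_nearestPoints hX hp₀ (key w).1
        have h3 : projPoint X w₀ ≤ projPoint X w := by nlinarith
        nlinarith
    filter_upwards [hloc, hc.isOpen_compl.eventually_mem hw₀] with w h1 h2 t ht
    rw [h1, ht.2.2 h2]; ring

theorem mem_intervalSlopes_of_hasDerivAt {X : Set ℝ} (hc : IsClosed X) (hX : X.OrdConnected)
    (hne : X.Nonempty) {w t : ℝ} (h : HasDerivAt (projPoint X) t w) : t ∈ intervalSlopes X w := by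
  have h0 : 0 ≤ t := h.deriv ▸ (monotone_projPoint hc hX hne).deriv_nonneg
  have h1 : 0 ≤ 1 - t := ((hasDerivAt_id w).sub h).deriv ▸
    (monotone_id_sub_projPoint hc hX hne).deriv_nonneg
  -- the projection is affine with slope `t'` near `w`, if `t'` is admissible nearby
  have huniq : ∀ t' : ℝ, (∀ᶠ z in 𝓝 w, t' ∈ intervalSlopes X z) → t = t' := by
    intro t' ht'
    refine h.unique ?_
    have he : projPoint X =ᶠ[𝓝 w] fun z => t' * (z - w) + projPoint X w := by
      filter_upwards [ht', eventually_projPoint_sub_eq hc hX hne w] with z hz hz'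
      rw [← hz' _ hz]; ring
    refine HasDerivAt.congr_of_eventuallyEq ?_ he
    simpa using (((hasDerivAt_id w).sub_const w).const_mul t').add_const (projPoint X w)
  refine ⟨⟨h0, by linarith⟩, fun hw => huniq 1 ?_, fun hw => huniq 0 ?_⟩
  · filter_upwards [isOpen_interior.eventually_mem hw] with z hz
    exact ⟨by norm_num, fun _ => rfl, fun h' => absurd (interior_subset hz) h'⟩
  · filter_upwards [hc.isOpen_compl.eventually_mem hw] with z hz
    exact ⟨by norm_num, fun h' => absurd (interior_subset h') hz, fun _ => rfl⟩

/-! ### The Fischer–Burmeister function -/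

/-- The Clarke subdifferential of the Euclidean norm of the plane at `(a, b)`: the unit vector
`(a, b) / √(a² + b²)`, or the closed unit disc at the origin. The subdifferential of
`fischerBurmeister` is its translate by `(-1, -1)`. -/
def normSlopes (a b : ℝ) : Set (ℝ × ℝ) :=
  {p | p.1 ^ 2 + p.2 ^ 2 ≤ 1 ∧ √(a ^ 2 + b ^ 2) * p.1 = a ∧ √(a ^ 2 + b ^ 2) * p.2 = b}

theorem mem_normSlopes_div {a b : ℝ} (h : 0 < √(a ^ 2 + b ^ 2)) :
    (a / √(a ^ 2 + b ^ 2), b / √(a ^ 2 + b ^ 2)) ∈ normSlopes a b := by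
  refine ⟨?_, mul_div_cancel₀ _ h.ne', mul_div_cancel₀ _ h.ne'⟩
  simp only [div_pow]
  rw [Real.sq_sqrt (by positivity), ← add_div]
  exact div_self_le_one _

theorem normSlopes_nonempty (a b : ℝ) : (normSlopes a b).Nonempty := by
  rcases (Real.sqrt_nonneg (a ^ 2 + b ^ 2)).eq_or_lt with h | h
  · have h0 := (Real.sqrt_eq_zero (by positivity)).1 h.symm
    have ha : a = 0 := by nlinarith
    have hb : b = 0 := by nlinarith
    exact ⟨(0, 0), by simp [normSlopes, ha, hb]⟩
  · exact ⟨_, mem_normSlopes_div h⟩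

theorem convex_normSlopes (a b : ℝ) : Convex ℝ (normSlopes a b) := by
  rintro ⟨x, y⟩ ⟨h, h1, h2⟩ ⟨x', y'⟩ ⟨h', h1', h2'⟩ α β hα hβ hαβ
  refine ⟨?_, ?_, ?_⟩
  · simp only [Prod.smul_mk, Prod.mk_add_mk, smul_eq_mul] at *
    obtain rfl : β = 1 - α := by linarith
    nlinarith [mul_nonneg (mul_nonneg hα hβ) (sq_nonneg (x - x')),
      mul_nonneg (mul_nonneg hα hβ) (sq_nonneg (y - y'))]
  · simp only [Prod.smul_mk, Prod.mk_add_mk, smul_eq_mul] at *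
    linear_combination α * h1 + β * h1' + a * hαβ
  · simp only [Prod.smul_mk, Prod.mk_add_mk, smul_eq_mul] at *
    linear_combination α * h2 + β * h2' + b * hαβ

theorem isClosed_graph_normSlopes :
    IsClosed {q : (ℝ × ℝ) × (ℝ × ℝ) | q.2 ∈ normSlopes q.1.1 q.1.2} := by
  have h1 : IsClosed {q : (ℝ × ℝ) × (ℝ × ℝ) | q.2.1 ^ 2 + q.2.2 ^ 2 ≤ 1} :=
    isClosed_le (by fun_prop) (by fun_prop)
  have h2 : IsClosed {q : (ℝ × ℝ) × (ℝ × ℝ) | √(q.1.1 ^ 2 + q.1.2 ^ 2) * q.2.1 = q.1.1} :=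
    isClosed_eq (by fun_prop) (by fun_prop)
  have h3 : IsClosed {q : (ℝ × ℝ) × (ℝ × ℝ) | √(q.1.1 ^ 2 + q.1.2 ^ 2) * q.2.2 = q.1.2} :=
    isClosed_eq (by fun_prop) (by fun_prop)
  exact h1.inter (h2.inter h3)

/-- Semismoothness of the Fischer–Burmeister function. By homogeneity the remainder is
`ξ a₀ + ζ b₀ - √(a₀² + b₀²)`, which vanishes when `(a₀, b₀) = 0` and is quadratically small
otherwise. -/
theorem eventually_fischerBurmeister_sub_le (a₀ b₀ : ℝ) {δ : ℝ} (hδ : 0 < δ) :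
    ∀ᶠ q : ℝ × ℝ in 𝓝 (a₀, b₀), ∀ p ∈ normSlopes q.1 q.2,
      |fischerBurmeister q.1 q.2 - fischerBurmeister a₀ b₀ -
        ((p.1 - 1) * (q.1 - a₀) + (p.2 - 1) * (q.2 - b₀))| ≤
          δ * (|q.1 - a₀| + |q.2 - b₀|) := by
  set r₀ := √(a₀ ^ 2 + b₀ ^ 2) with hr₀
  have hred : ∀ q : ℝ × ℝ, ∀ p ∈ normSlopes q.1 q.2,
      fischerBurmeister q.1 q.2 - fischerBurmeister a₀ b₀ -
        ((p.1 - 1) * (q.1 - a₀) + (p.2 - 1) * (q.2 - b₀)) = p.1 * a₀ + p.2 * b₀ - r₀ := by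
    rintro ⟨a, b⟩ ⟨ξ, ζ⟩ ⟨h, h1, h2⟩
    simp only [fischerBurmeister] at *
    rw [← hr₀]
    have hsq : √(a ^ 2 + b ^ 2) ^ 2 = a ^ 2 + b ^ 2 := Real.sq_sqrt (by positivity)
    set r := √(a ^ 2 + b ^ 2)
    have hr : r = ξ * a + ζ * b := by
      by_cases h0 : r = 0
      · rw [← h1, ← h2, h0]; ring
      · apply mul_left_cancel₀ h0
        linear_combination hsq - a * h1 - b * h2
    linear_combination hr
  rcases (Real.sqrt_nonneg (a₀ ^ 2 + b₀ ^ 2)).eq_or_lt with h | h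
  · have h0 := (Real.sqrt_eq_zero (by positivity)).1 h.symm
    have ha : a₀ = 0 := by nlinarith
    have hb : b₀ = 0 := by nlinarith
    refine Eventually.of_forall fun q p hp => ?_
    rw [hred q p hp, hr₀, ← h, ha, hb]
    simp only [mul_zero, add_zero, sub_zero, abs_zero]
    positivity
  · have e1 : ∀ᶠ q : ℝ × ℝ in 𝓝 (a₀, b₀), r₀ / 2 < √(q.1 ^ 2 + q.2 ^ 2) := by
      have hcont : Continuous fun q : ℝ × ℝ => √(q.1 ^ 2 + q.2 ^ 2) := by fun_prop
      exact hcont.continuousAt.eventually (lt_mem_nhds (show r₀ / 2 < r₀ by linarith))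
    have e2 : ∀ᶠ q : ℝ × ℝ in 𝓝 (a₀, b₀), |q.1 - a₀| + |q.2 - b₀| < δ * r₀ := by
      have hcont : Continuous fun q : ℝ × ℝ => |q.1 - a₀| + |q.2 - b₀| := by fun_prop
      refine hcont.continuousAt.eventually (gt_mem_nhds ?_)
      simpa using mul_pos hδ h
    filter_upwards [e1, e2] with q h1 h2 p hp
    rw [hred q p hp]
    obtain ⟨a, b⟩ := q
    obtain ⟨ξ, ζ⟩ := p
    obtain ⟨h3, h4, h5⟩ := hp
    simp only at *
    have hsq : √(a ^ 2 + b ^ 2) ^ 2 = a ^ 2 + b ^ 2 := Real.sq_sqrt (by positivity)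
    have hsq₀ : r₀ ^ 2 = a₀ ^ 2 + b₀ ^ 2 := Real.sq_sqrt (by positivity)
    set r := √(a ^ 2 + b ^ 2)
    set D := |a - a₀| + |b - b₀| with hD
    have hD0 : 0 ≤ D := by positivity
    have hDsq : (a - a₀) ^ 2 + (b - b₀) ^ 2 ≤ D ^ 2 := by
      rw [hD, ← sq_abs (a - a₀), ← sq_abs (b - b₀)]
      nlinarith [mul_nonneg (abs_nonneg (a - a₀)) (abs_nonneg (b - b₀))]
    have hrpos : 0 < r := by linarith
    -- `2 (r r₀ - a a₀ - b b₀) = |(a, b) - (a₀, b₀)|² - (r - r₀)²`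
    have hup : r * (r₀ - (ξ * a₀ + ζ * b₀)) ≤ D ^ 2 / 2 := by
      have : r * (r₀ - (ξ * a₀ + ζ * b₀)) = r * r₀ - a * a₀ - b * b₀ := by
        linear_combination (-a₀) * h4 - b₀ * h5
      rw [this]
      nlinarith [sq_nonneg (r - r₀)]
    have hlo : 0 ≤ r₀ - (ξ * a₀ + ζ * b₀) := by
      have hCS : (ξ * a₀ + ζ * b₀) ^ 2 ≤ r₀ ^ 2 := by
        rw [hsq₀]
        nlinarith [sq_nonneg (ξ * b₀ - ζ * a₀), sq_nonneg a₀, sq_nonneg b₀]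
      linarith [(abs_le.1 (abs_le_of_sq_le_sq hCS h.le)).2]
    rw [abs_sub_comm, abs_of_nonneg hlo]
    have hb1 : r₀ / 2 * (r₀ - (ξ * a₀ + ζ * b₀)) ≤ D ^ 2 / 2 := by nlinarith
    have hb2 : D ^ 2 / 2 ≤ r₀ / 2 * (δ * D) := by nlinarith
    exact le_of_mul_le_mul_left (hb1.trans hb2) (by linarith)

theorem hasFDerivAt_fischerBurmeister_comp {E : Type*} [NormedAddCommGroup E] [NormedSpace ℝ E]
    {g h : E → ℝ} {g' h' : E →L[ℝ] ℝ} {u : E} (hg : HasFDerivAt g g' u) (hh : HasFDerivAt h h' u)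
    (hpos : 0 < √(g u ^ 2 + h u ^ 2)) :
    HasFDerivAt (fun y => fischerBurmeister (g y) (h y))
      ((g u / √(g u ^ 2 + h u ^ 2) - 1) • g' + (h u / √(g u ^ 2 + h u ^ 2) - 1) • h') u := by
  have h1 := ((hg.pow 2).add (hh.pow 2)).sqrt (Real.sqrt_pos.1 hpos).ne'
  refine ((h1.sub hg).sub hh).congr_fderiv ?_
  ext v
  simp
  field_simp
  ring

/-- If `g` does not change along a direction in which `h` does, then `fischerBurmeister g h` is
not differentiable at the common zeros of `g` and `h`. -/
theorem sqrt_pos_of_differentiableAt_fischerBurmeister {E : Type*} [NormedAddCommGroup E]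
    [NormedSpace ℝ E] {g h : E → ℝ} {u e : E}
    (hd : DifferentiableAt ℝ (fun y => fischerBurmeister (g y) (h y)) u)
    (hg : ∀ s : ℝ, g (u + s • e) = g u) (hh : ∀ s : ℝ, h (u + s • e) = h u + s) :
    0 < √(g u ^ 2 + h u ^ 2) := by
  refine (Real.sqrt_nonneg _).lt_of_ne fun h0 => ?_
  have h1 := (Real.sqrt_eq_zero (by positivity)).1 h0.symm
  have hgu : g u = 0 := by nlinarith
  have hhu : h u = 0 := by nlinarith
  have hline : DifferentiableAt ℝ (fun s : ℝ => u + s • e) 0 := by fun_prop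
  have hd' : DifferentiableAt ℝ (fun y => fischerBurmeister (g y) (h y)) (u + (0 : ℝ) • e) := by
    simpa using hd
  have h2 := (hd'.comp (0 : ℝ) hline).add differentiableAt_id
  refine not_differentiableAt_abs_zero (h2.congr_of_eventuallyEq (Eventually.of_forall ?_))
  intro s
  simp [fischerBurmeister, hg, hh, hgu, hhu, Real.sqrt_sq_eq_abs]

/-! ### Two elementary inequalities -/

/-- Numbers that balance with nonnegative weights, not both zero, have the same sign. -/
theorem mul_nonneg_of_weighted_eq {α β p q : ℝ} (hα : 0 ≤ α) (hβ : 0 ≤ β) (hαβ : 0 < α + β)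
    (h : α * p = β * q) : 0 ≤ p * q := by
  have : (α + β) * (p * q) = β * q ^ 2 + α * p ^ 2 := by linear_combination (q - p) * h
  refine nonneg_of_mul_nonneg_right (a := α + β) ?_ hαβ
  rw [this]
  positivity

theorem EuclideanSpace.norm_le_sum_abs {ι : Type*} [Fintype ι] (v : EuclideanSpace ℝ ι) :
    ‖v‖ ≤ ∑ j, |v j| := by
  rw [EuclideanSpace.norm_eq]
  refine Real.sqrt_le_iff.2 ⟨by positivity, ?_⟩
  simp only [Real.norm_eq_abs]
  exact Finset.sum_sq_le_sq_sum_of_nonneg fun _ _ => abs_nonneg _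

/-! ### Local behaviour of semismooth Newton steps -/

/-- Locally uniform nonsingularity: if the parameters range in a compact set, the graph of the
admissible parameters is closed and every admissible operator at `y₀` is injective, then all
admissible operators at points near `y₀` share a lower and an upper bound. -/
theorem exists_eventually_bounds {E G Θ : Type*} [NormedAddCommGroup E] [NormedSpace ℝ E]
    [FiniteDimensional ℝ E] [NormedAddCommGroup G] [NormedSpace ℝ G] [TopologicalSpace Θ]
    {B : Set Θ} (hB : IsCompact B) {K : E → Set Θ} (hKB : ∀ y, K y ⊆ B)
    (hK : IsClosed {q : E × Θ | q.2 ∈ K q.1}) {M : E → Θ → E →L[ℝ] G}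
    (hM : Continuous fun q : E × Θ => M q.1 q.2) {y₀ : E}
    (hinj : ∀ θ ∈ K y₀, Function.Injective (M y₀ θ)) :
    ∃ c > 0, ∃ C > 0, ∀ᶠ y in 𝓝 y₀, ∀ θ ∈ K y, ∀ v,
      c * ‖v‖ ≤ ‖M y θ v‖ ∧ ‖M y θ v‖ ≤ C * ‖v‖ := by
  suffices h : ∃ c > 0, ∃ C > 0, ∀ᶠ y in 𝓝 y₀, ∀ θ ∈ B, θ ∈ K y → ∀ v,
      c * ‖v‖ ≤ ‖M y θ v‖ ∧ ‖M y θ v‖ ≤ C * ‖v‖ by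
    obtain ⟨c, hc, C, hC, h⟩ := h
    exact ⟨c, hc, C, hC, h.mono fun y hy θ hθ => hy θ (hKB y hθ) hθ⟩
  refine hB.induction_on (p := fun s => ∃ c > 0, ∃ C > 0, ∀ᶠ y in 𝓝 y₀, ∀ θ ∈ s, θ ∈ K y → ∀ v,
      c * ‖v‖ ≤ ‖M y θ v‖ ∧ ‖M y θ v‖ ≤ C * ‖v‖) ?_ ?_ ?_ ?_
  · exact ⟨1, one_pos, 1, one_pos, Eventually.of_forall fun y θ hθ => hθ.elim⟩
  · rintro s t hst ⟨c, hc, C, hC, h⟩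
    exact ⟨c, hc, C, hC, h.mono fun y hy θ hθ => hy θ (hst hθ)⟩
  · rintro s t ⟨c, hc, C, hC, h⟩ ⟨c', hc', C', hC', h'⟩
    refine ⟨min c c', lt_min hc hc', max C C', lt_max_of_lt_left hC, ?_⟩
    filter_upwards [h, h'] with y hy hy' θ hθ hθK v
    rcases hθ with hθ | hθ
    · obtain ⟨h1, h2⟩ := hy θ hθ hθK v
      exact ⟨le_trans (by gcongr; exact min_le_left _ _) h1,
        h2.trans (by gcongr; exact le_max_left _ _)⟩
    · obtain ⟨h1, h2⟩ := hy' θ hθ hθK v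
      exact ⟨le_trans (by gcongr; exact min_le_right _ _) h1,
        h2.trans (by gcongr; exact le_max_right _ _)⟩
  · intro θ₀ _
    suffices h : ∃ c > 0, ∃ C > 0, ∀ᶠ q : E × Θ in 𝓝 (y₀, θ₀), q.2 ∈ K q.1 → ∀ v,
        c * ‖v‖ ≤ ‖M q.1 q.2 v‖ ∧ ‖M q.1 q.2 v‖ ≤ C * ‖v‖ by
      obtain ⟨c, hc, C, hC, h⟩ := h
      rw [nhds_prod_eq] at h
      obtain ⟨p1, h1, p2, h2, h⟩ := eventually_prod_iff.1 h
      exact ⟨{θ | p2 θ}, mem_nhdsWithin_of_mem_nhds h2, c, hc, C, hC,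
        h1.mono fun y hy θ hθ => h hy hθ⟩
    by_cases hθ₀ : θ₀ ∈ K y₀
    · obtain ⟨κ, hκ, hanti⟩ := LinearMap.exists_antilipschitzWith (M y₀ θ₀ : E →ₗ[ℝ] G)
        (LinearMap.ker_eq_bot.2 (hinj θ₀ hθ₀))
      have hκ' : (0 : ℝ) < κ := hκ
      have hlow : ∀ v, ‖v‖ ≤ κ * ‖M y₀ θ₀ v‖ := fun v => by
        simpa [dist_eq_norm] using hanti.le_mul_dist v 0
      refine ⟨1 / (2 * κ), by positivity, ‖M y₀ θ₀‖ + 1 / (2 * κ), by positivity, ?_⟩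
      have hnear : ∀ᶠ q : E × Θ in 𝓝 (y₀, θ₀), ‖M q.1 q.2 - M y₀ θ₀‖ < 1 / (2 * κ) := by
        have := hM.continuousAt (x := (y₀, θ₀))
        filter_upwards [this (Metric.ball_mem_nhds _ (show (0 : ℝ) < 1 / (2 * κ) by positivity))]
          with q hq
        simpa [dist_eq_norm] using hq
      filter_upwards [hnear] with q hq _ v
      have h1 : ‖M q.1 q.2 v - M y₀ θ₀ v‖ ≤ 1 / (2 * κ) * ‖v‖ :=
        ((M q.1 q.2 - M y₀ θ₀).le_opNorm v).trans (by gcongr)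
      have h2 := norm_sub_norm_le (M y₀ θ₀ v) (M q.1 q.2 v)
      have h3 := norm_sub_norm_le (M q.1 q.2 v) (M y₀ θ₀ v)
      rw [norm_sub_rev] at h2
      have h4 : 2 * (1 / (2 * κ) * ‖v‖) ≤ ‖M y₀ θ₀ v‖ := by
        have := hlow v
        field_simp
        linarith
      have h5 := (M y₀ θ₀).le_opNorm v
      constructor <;> nlinarith
    · refine ⟨1, one_pos, 1, one_pos, ?_⟩
      filter_upwards [hK.isOpen_compl.eventually_mem (x := (y₀, θ₀)) hθ₀] with q hq hq'
      exact absurd hq' hq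

/-- An injective operator between spaces of equal finite dimension is invertible. -/
theorem isInvertible_of_finrank_eq {E G : Type*} [NormedAddCommGroup E] [NormedSpace ℝ E]
    [FiniteDimensional ℝ E] [NormedAddCommGroup G] [NormedSpace ℝ G] [FiniteDimensional ℝ G]
    (hdim : Module.finrank ℝ E = Module.finrank ℝ G) {W : E →L[ℝ] G}
    (hW : Function.Injective W) : W.IsInvertible := by
  refine ⟨(LinearEquiv.ofInjectiveOfFinrankEq (W : E →ₗ[ℝ] G) hW hdim).toContinuousLinearEquiv, ?_⟩
  ext v
  rfl

/-- Semismooth Newton steps from points near a zero `y₀` of `f` reduce the residual by any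
prescribed factor, as long as the operators in use are uniformly nonsingular and bounded and
linearise `f` at `y₀` up to `o(‖y - y₀‖)`. -/
theorem eventually_norm_newton_le {E G Θ : Type*} [NormedAddCommGroup E] [NormedSpace ℝ E]
    [FiniteDimensional ℝ E] [NormedAddCommGroup G] [NormedSpace ℝ G] [FiniteDimensional ℝ G]
    (hdim : Module.finrank ℝ E = Module.finrank ℝ G)
    {K : E → Set Θ} (hKne : ∀ y, (K y).Nonempty) {M : E → Θ → E →L[ℝ] G} {y₀ : E} {f : E → G}
    (hf : f y₀ = 0)
    (hbd : ∃ c > 0, ∃ C > 0, ∀ᶠ y in 𝓝 y₀, ∀ θ ∈ K y, ∀ v,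
      c * ‖v‖ ≤ ‖M y θ v‖ ∧ ‖M y θ v‖ ≤ C * ‖v‖)
    (hsemi : ∀ δ > 0, ∀ᶠ y in 𝓝 y₀, ∀ θ ∈ K y,
      ‖f y - f y₀ - M y θ (y - y₀)‖ ≤ δ * ‖y - y₀‖) {ε : ℝ} (hε : 0 < ε) :
    ∀ᶠ y in 𝓝 y₀, ∀ W ∈ M y '' K y,
      W.IsInvertible ∧ ‖f (y - W.inverse (f y))‖ ≤ ε * ‖f y‖ := by
  obtain ⟨c, hc, C, hC, hbd⟩ := hbd
  set δ := min (c / 2) (ε * c ^ 2 / (2 * (C + c))) with hδ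
  have hδ0 : 0 < δ := by positivity
  have hδc : δ ≤ c / 2 := min_le_left _ _
  have hδε : δ * (2 * (C + c)) ≤ ε * c ^ 2 := by
    rw [← le_div_iff₀ (by positivity)]; exact min_le_right _ _
  obtain ⟨r, hr, hball⟩ := Metric.eventually_nhds_iff.1 (hbd.and (hsemi δ hδ0))
  refine Metric.eventually_nhds_iff.2 ⟨r, hr, ?_⟩
  rintro y hy _ ⟨θ, hθ, rfl⟩
  obtain ⟨hb, hs⟩ := hball hy
  have hb1 := fun v => (hb θ hθ v).1
  have hs1 := hs θ hθ
  rw [hf, sub_zero] at hs1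
  set W := M y θ
  have hinj : Function.Injective W := by
    refine (injective_iff_map_eq_zero W).2 fun v hv => ?_
    have := hb1 v
    rw [hv, norm_zero] at this
    exact norm_le_zero_iff.1 (by nlinarith [norm_nonneg v])
  have hinv := isInvertible_of_finrank_eq hdim hinj
  refine ⟨hinv, ?_⟩
  set z := y - W.inverse (f y) with hz
  have hWz : W (z - y₀) = -(f y - W (y - y₀)) := by
    have h1 : z - y₀ = (y - y₀) - W.inverse (f y) := by rw [hz]; abel
    rw [h1, map_sub, hinv.self_apply_inverse]
    abel
  have hz1 : c * ‖z - y₀‖ ≤ δ * ‖y - y₀‖ := by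
    have := hb1 (z - y₀)
    rw [hWz, norm_neg] at this
    exact this.trans hs1
  have hzle : ‖z - y₀‖ ≤ ‖y - y₀‖ := by
    refine le_of_mul_le_mul_left (hz1.trans ?_) hc
    gcongr
    linarith
  -- the residual controls the error: `c ‖y - y₀‖ ≤ ‖W (y - y₀)‖ ≤ ‖f y‖ + δ ‖y - y₀‖`
  have herr : c / 2 * ‖y - y₀‖ ≤ ‖f y‖ := by
    have h1 := hb1 (y - y₀)
    have h2 : ‖W (y - y₀)‖ ≤ ‖f y‖ + ‖f y - W (y - y₀)‖ := by
      simpa using norm_sub_le (f y) (f y - W (y - y₀))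
    have h3 : δ * ‖y - y₀‖ ≤ c / 2 * ‖y - y₀‖ := by gcongr
    linarith
  obtain ⟨hb', hs'⟩ := hball (y := z)
    (by rw [dist_eq_norm] at hy ⊢; exact hzle.trans_lt hy)
  obtain ⟨θ', hθ'⟩ := hKne z
  have hfz : ‖f z‖ ≤ (C + δ) * ‖z - y₀‖ := by
    have h1 := hs' θ' hθ'
    rw [hf, sub_zero] at h1
    have h2 := (hb' θ' hθ' (z - y₀)).2
    have h3 : ‖f z‖ ≤ ‖f z - M z θ' (z - y₀)‖ + ‖M z θ' (z - y₀)‖ := by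
      simpa using norm_add_le (f z - M z θ' (z - y₀)) (M z θ' (z - y₀))
    linarith
  have h1 : c ^ 2 * ‖f z‖ ≤ c ^ 2 * (ε * ‖f y‖) := by
    calc c ^ 2 * ‖f z‖ ≤ c ^ 2 * ((C + c) * ‖z - y₀‖) := by
          gcongr
          exact hfz.trans (by gcongr; linarith)
      _ = c * (C + c) * (c * ‖z - y₀‖) := by ring
      _ ≤ c * (C + c) * (δ * ‖y - y₀‖) := by gcongr
      _ = δ * (2 * (C + c)) * (c / 2 * ‖y - y₀‖) := by ring
      _ ≤ ε * c ^ 2 * ‖f y‖ := by gcongr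
      _ = c ^ 2 * (ε * ‖f y‖) := by ring
  exact le_of_mul_le_mul_left h1 (by positivity)

/-- An outer bound for the Clarke Jacobian: it suffices to parametrize the derivatives at points
of differentiability by a closed relation with compact range and convex operator values. -/
theorem clarkeJacobian_subset_image {E G Θ : Type*} [NormedAddCommGroup E] [NormedSpace ℝ E]
    [NormedAddCommGroup G] [NormedSpace ℝ G] [TopologicalSpace Θ] [FirstCountableTopology Θ]
    {B : Set Θ} (hB : IsCompact B) {K : E → Set Θ} (hKB : ∀ y, K y ⊆ B)
    (hK : IsClosed {q : E × Θ | q.2 ∈ K q.1}) {M : E → Θ → E →L[ℝ] G}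
    (hM : Continuous fun q : E × Θ => M q.1 q.2) {f : E → G}
    (hf : ∀ y, DifferentiableAt ℝ f y → fderiv ℝ f y ∈ M y '' K y) {y : E}
    (hconv : Convex ℝ (M y '' K y)) : clarkeJacobian f y ⊆ M y '' K y := by
  refine convexHull_min ?_ hconv
  rintro W ⟨u, hu, hlim, hW⟩
  choose θ hθ hθW using fun l => hf (u l) (hu l)
  obtain ⟨θ₀, -, φ, hφ, hθ₀⟩ := hB.tendsto_subseq fun l => hKB _ (hθ l)
  have hpair : Tendsto (fun l => (u (φ l), θ (φ l))) atTop (𝓝 (y, θ₀)) :=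
    (hlim.comp hφ.tendsto_atTop).prodMk_nhds hθ₀
  refine ⟨θ₀, hK.mem_of_tendsto hpair (Eventually.of_forall fun l => hθ (φ l)), ?_⟩
  have h1 := (hM.tendsto (y, θ₀)).comp hpair
  refine tendsto_nhds_unique h1 ((hW.comp hφ.tendsto_atTop).congr fun l => ?_)
  exact (hθW (φ l)).symm

/-- A continuously differentiable map is semismooth: the derivatives at nearby points linearise
it at `y₀`. -/
theorem ContDiff.eventually_norm_sub_fderiv_le {E G : Type*} [NormedAddCommGroup E]
    [NormedSpace ℝ E] [NormedAddCommGroup G] [NormedSpace ℝ G] {g : E → G}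
    (hg : ContDiff ℝ 1 g) (y₀ : E) {δ : ℝ} (hδ : 0 < δ) :
    ∀ᶠ y in 𝓝 y₀, ‖g y - g y₀ - fderiv ℝ g y (y - y₀)‖ ≤ δ * ‖y - y₀‖ := by
  have h1 := ((hg.differentiable (by norm_num)) y₀).hasFDerivAt.isLittleO.def
    (show 0 < δ / 2 by positivity)
  have h2 : ∀ᶠ y in 𝓝 y₀, ‖fderiv ℝ g y - fderiv ℝ g y₀‖ < δ / 2 := by
    filter_upwards [(hg.continuous_fderiv (by norm_num)).continuousAt (x := y₀)
      (Metric.ball_mem_nhds _ (show 0 < δ / 2 by positivity))] with y hy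
    simpa [dist_eq_norm] using hy
  filter_upwards [h1, h2] with y h1 h2
  have h3 := (fderiv ℝ g y - fderiv ℝ g y₀).le_of_opNorm_le h2.le (y - y₀)
  have h4 : g y - g y₀ - fderiv ℝ g y (y - y₀) = (g y - g y₀ - fderiv ℝ g y₀ (y - y₀)) -
      (fderiv ℝ g y - fderiv ℝ g y₀) (y - y₀) := by
    simp
  rw [h4]
  refine (norm_sub_le _ _).trans ?_
  linarith

/-- Semismoothness of the Fischer–Burmeister function composed with smooth functions. -/
theorem eventually_fischerBurmeister_comp_sub_le {E : Type*} [NormedAddCommGroup E]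
    [NormedSpace ℝ E] {g h : E → ℝ} (hg : ContDiff ℝ 1 g) (hh : ContDiff ℝ 1 h) (y₀ : E) {δ : ℝ}
    (hδ : 0 < δ) :
    ∀ᶠ y in 𝓝 y₀, ∀ p ∈ normSlopes (g y) (h y),
      |fischerBurmeister (g y) (h y) - fischerBurmeister (g y₀) (h y₀) -
        ((p.1 - 1) * fderiv ℝ g y (y - y₀) + (p.2 - 1) * fderiv ℝ h y (y - y₀))| ≤
          δ * ‖y - y₀‖ := by
  obtain ⟨C, hC, hgC⟩ := ((hg.differentiable (by norm_num)) y₀).isBigO_sub.exists_pos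
  obtain ⟨D, hD, hhD⟩ := ((hh.differentiable (by norm_num)) y₀).isBigO_sub.exists_pos
  have h1 := (hg.continuous.prodMk hh.continuous).continuousAt (x := y₀) |>.eventually
    (eventually_fischerBurmeister_sub_le (g y₀) (h y₀)
      (show 0 < δ / (2 * (C + D)) by positivity))
  filter_upwards [h1, hgC.bound, hhD.bound,
    hg.eventually_norm_sub_fderiv_le y₀ (show 0 < δ / 8 by positivity),
    hh.eventually_norm_sub_fderiv_le y₀ (show 0 < δ / 8 by positivity)] with y h1 h2 h3 h4 h5 p hp
  have h6 := h1 p hp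
  obtain ⟨hp1, -, -⟩ := hp
  rw [Real.norm_eq_abs] at h2 h3 h4 h5
  have h7 : δ / (2 * (C + D)) * (|g y - g y₀| + |h y - h y₀|) ≤ δ / 2 * ‖y - y₀‖ := by
    calc _ ≤ δ / (2 * (C + D)) * (C * ‖y - y₀‖ + D * ‖y - y₀‖) := by gcongr
      _ = _ := by field_simp
  have hb1 : |p.1 - 1| ≤ 2 := by rw [abs_le]; constructor <;> nlinarith
  have hb2 : |p.2 - 1| ≤ 2 := by rw [abs_le]; constructor <;> nlinarith
  have h8 : |(p.1 - 1) * (g y - g y₀ - fderiv ℝ g y (y - y₀))| ≤ 2 * (δ / 8 * ‖y - y₀‖) := by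
    rw [abs_mul]; gcongr
  have h9 : |(p.2 - 1) * (h y - h y₀ - fderiv ℝ h y (y - y₀))| ≤ 2 * (δ / 8 * ‖y - y₀‖) := by
    rw [abs_mul]; gcongr
  simp only [abs_le] at h6 h8 h9 ⊢
  constructor <;> nlinarith

/-! ### Derivatives of the Lagrangian and of the constraints -/

namespace PrimalDual

variable {n k m : ℕ}

/-- The block `x` as a continuous linear map. -/
noncomputable def xL : PrimalDual n k m →L[ℝ] EuclideanSpace ℝ (Fin n) :=
  LinearMap.toContinuousLinearMap
    { toFun := PrimalDual.x, map_add' := fun _ _ => rfl, map_smul' := fun _ _ => rfl }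

/-- The block `ν` as a continuous linear map. -/
noncomputable def νL : PrimalDual n k m →L[ℝ] EuclideanSpace ℝ (Fin n) :=
  LinearMap.toContinuousLinearMap
    { toFun := PrimalDual.ν, map_add' := fun _ _ => rfl, map_smul' := fun _ _ => rfl }

/-- The multiplier of a constraint, quadratic or linear, as a continuous linear functional. -/
noncomputable def multL (c : Fin k ⊕ Fin m) : PrimalDual n k m →L[ℝ] ℝ :=
  EuclideanSpace.proj (Sum.inr (Sum.inr c))

theorem xL_apply (Y : PrimalDual n k m) : xL Y = Y.x := rfl

theorem νL_apply (Y : PrimalDual n k m) : νL Y = Y.ν := rfl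

theorem multL_inl (Y : PrimalDual n k m) (i : Fin k) : multL (Sum.inl i) Y = Y.μ i := rfl

theorem multL_inr (Y : PrimalDual n k m) (i : Fin m) : multL (Sum.inr i) Y = Y.lam i := rfl

theorem eq_zero_of_blocks {Y : PrimalDual n k m} (hx : Y.x = 0) (hν : Y.ν = 0)
    (hc : ∀ c, multL c Y = 0) : Y = 0 := by
  ext j
  rcases j with j | j | c
  · exact congrArg (fun z : EuclideanSpace ℝ (Fin n) => z j) hx
  · exact congrArg (fun z : EuclideanSpace ℝ (Fin n) => z j) hν
  · exact hc c

end PrimalDual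

namespace SQCQP

open PrimalDual

variable {n k m : ℕ} (P : SQCQP n k m)

/-- The matrix `Q_i` as an operator of the Euclidean space. -/
noncomputable def QL (i : Fin (k + 1)) : EuclideanSpace ℝ (Fin n) →L[ℝ] EuclideanSpace ℝ (Fin n) :=
  Matrix.toEuclideanCLM (𝕜 := ℝ) (P.Q i)

theorem inner_QL_comm (i : Fin (k + 1)) (x y : EuclideanSpace ℝ (Fin n)) :
    inner ℝ (P.QL i x) y = inner ℝ x (P.QL i y) := by
  rw [← ContinuousLinearMap.adjoint_inner_right]
  congr 2
  rw [QL, ← ContinuousLinearMap.star_eq_adjoint, ← map_star, Matrix.star_eq_conjTranspose,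
    Matrix.conjTranspose_eq_transpose_of_trivial, P.Q_symm i]

theorem f_eq (i : Fin (k + 1)) (x : EuclideanSpace ℝ (Fin n)) :
    P.f i x = 1 / 2 * inner ℝ x (P.QL i x) + inner ℝ (P.q i) x + P.c i := by
  simp only [f, QL, EuclideanSpace.inner_eq_star_dotProduct, Matrix.ofLp_toEuclideanCLM,
    star_trivial]
  rw [dotProduct_comm x.ofLp, dotProduct_comm (P.q i).ofLp]

theorem hasFDerivAt_f (i : Fin (k + 1)) (x : EuclideanSpace ℝ (Fin n)) :
    HasFDerivAt (P.f i) (innerSL ℝ (P.QL i x + P.q i)) x := by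
  have h1 := ((((hasFDerivAt_id x).inner ℝ ((P.QL i).hasFDerivAt (x := x))).const_mul
    (1 / 2 : ℝ)).add ((innerSL ℝ (P.q i)).hasFDerivAt (x := x))).add_const (P.c i)
  have h2 : P.f i = fun x => 1 / 2 * inner ℝ x (P.QL i x) + innerSL ℝ (P.q i) x + P.c i :=
    funext fun x => by rw [P.f_eq i x]; rfl
  rw [h2]
  refine h1.congr_fderiv ?_
  ext v
  have h3 := P.inner_QL_comm i x v
  have h4 := real_inner_comm (P.QL i x) v
  simp at h3 h4 ⊢
  linarith

theorem gradient_f (i : Fin (k + 1)) (x : EuclideanSpace ℝ (Fin n)) :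
    gradient (P.f i) x = P.QL i x + P.q i :=
  HasGradientAt.gradient (P.hasFDerivAt_f i x)

/-- The slack of a constraint, quadratic or linear. -/
noncomputable def slack (c : Fin k ⊕ Fin m) (x : EuclideanSpace ℝ (Fin n)) : ℝ :=
  Sum.elim (fun i => -P.f i.succ x) (fun i => P.b i - inner ℝ (P.a i) x) c

/-- The gradient of a constraint function, quadratic or linear. -/
noncomputable def normal (c : Fin k ⊕ Fin m) (x : EuclideanSpace ℝ (Fin n)) :
    EuclideanSpace ℝ (Fin n) :=
  Sum.elim (fun i => P.QL i.succ x + P.q i.succ) (fun i => P.a i) c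

theorem hasFDerivAt_slack (c : Fin k ⊕ Fin m) (x : EuclideanSpace ℝ (Fin n)) :
    HasFDerivAt (P.slack c) (-innerSL ℝ (P.normal c x)) x := by
  rcases c with i | i
  · exact (P.hasFDerivAt_f i.succ x).neg
  · exact ((innerSL ℝ (P.a i)).hasFDerivAt (x := x)).const_sub (P.b i)

theorem contDiff_slack (c : Fin k ⊕ Fin m) : ContDiff ℝ 1 (P.slack c) := by
  rcases c with i | i
  · have : P.slack (Sum.inl i) = fun x => -(1 / 2 * inner ℝ x (P.QL i.succ x) +
        inner ℝ (P.q i.succ) x + P.c i.succ) := funext fun x => by rw [← f_eq]; rfl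
    rw [this]
    exact (((contDiff_const.mul (contDiff_id.inner ℝ (P.QL i.succ).contDiff)).add
      (contDiff_const.inner ℝ contDiff_id)).add contDiff_const).neg
  · have : P.slack (Sum.inr i) = fun x => P.b i - inner ℝ (P.a i) x := rfl
    rw [this]
    exact contDiff_const.sub (contDiff_const.inner ℝ contDiff_id)

theorem gradient_lagrangian (x : EuclideanSpace ℝ (Fin n)) (μ : EuclideanSpace ℝ (Fin k))
    (lam : EuclideanSpace ℝ (Fin m)) :
    gradient (fun z => P.lagrangian z μ lam) x =
      P.QL 0 x + P.q 0 + ∑ i, μ i • (P.QL i.succ x + P.q i.succ) + ∑ i, lam i • P.a i := by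
  refine HasGradientAt.gradient ?_
  have h1 := ((P.hasFDerivAt_f 0 x).add (HasFDerivAt.fun_sum (u := Finset.univ) fun i _ =>
    (P.hasFDerivAt_f (Fin.succ i) x).const_mul (μ i))).add (HasFDerivAt.fun_sum (u := Finset.univ)
      fun i _ => (((innerSL ℝ (P.a i)).hasFDerivAt (x := x)).sub_const (P.b i)).const_mul (lam i))
  refine HasFDerivAt.congr_fderiv (f := fun z => P.lagrangian z μ lam) h1 ?_
  ext v
  simp

theorem gradL_eq (Y : PrimalDual n k m) :
    P.gradL Y = P.QL 0 (xL Y) + P.q 0 +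
      ∑ i, multL (Sum.inl i) Y • (P.QL i.succ (xL Y) + P.q i.succ) +
        ∑ i, multL (Sum.inr i) Y • P.a i :=
  P.gradient_lagrangian Y.x Y.μ Y.lam

theorem hessL_apply (Y : PrimalDual n k m) (d : EuclideanSpace ℝ (Fin n)) :
    P.hessL Y d = P.QL 0 d + ∑ i, Y.μ i • P.QL i.succ d := by
  have h1 : HasFDerivAt (fun y => gradient (fun z => P.lagrangian z Y.μ Y.lam) y)
      (P.QL 0 + ∑ i, Y.μ i • P.QL i.succ) Y.x := by
    simp only [gradient_lagrangian]
    exact (((P.QL 0).hasFDerivAt.add_const _).add (HasFDerivAt.fun_sum fun i _ =>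
      (((P.QL (Fin.succ i)).hasFDerivAt (x := Y.x)).add_const _).const_smul (Y.μ i))).add_const _
  rw [hessL, h1.fderiv]
  simp

theorem contDiff_gradL : ContDiff ℝ 1 P.gradL := by
  rw [show P.gradL = _ from funext P.gradL_eq]
  fun_prop

theorem fderiv_gradL_apply (Y v : PrimalDual n k m) :
    fderiv ℝ P.gradL Y v = P.hessL Y v.x + ∑ c, multL c v • P.normal c Y.x := by
  have h0 : HasFDerivAt (fun Y : PrimalDual n k m => P.QL 0 (xL Y) + P.q 0)
      (P.QL 0 ∘L xL) Y := ((P.QL 0 ∘L xL).hasFDerivAt).add_const _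
  have h1 : ∀ i : Fin k, HasFDerivAt
      (fun Y : PrimalDual n k m => P.QL i.succ (xL Y) + P.q i.succ) (P.QL i.succ ∘L xL) Y :=
    fun i => ((P.QL i.succ ∘L xL).hasFDerivAt).add_const _
  have h2 := (h0.add (HasFDerivAt.fun_sum (u := Finset.univ) fun i _ =>
    ((multL (Sum.inl i)).hasFDerivAt (x := Y)).smul (h1 i))).add
      (HasFDerivAt.fun_sum (u := Finset.univ) fun i _ =>
        ((multL (Sum.inr i)).hasFDerivAt (x := Y)).smul_const (P.a i))
  have h3 := HasFDerivAt.congr_of_eventuallyEq (f₁ := P.gradL) h2 (Eventually.of_forall P.gradL_eq)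
  rw [h3.fderiv, hessL_apply, Fintype.sum_sum_type]
  simp [Finset.sum_add_distrib, xL_apply, multL_inl, normal]
  abel

/-! ### The linearised stationarity system -/

theorem mem_nearestPoints_of_box {T : Finset (Fin n)} {v p : EuclideanSpace ℝ T}
    (hp : p ∈ nearestPoints (P.box T) v) (i : T) : p i ∈ nearestPoints (P.X i) (v i) := by
  refine ⟨hp.1 i, fun y hy => ?_⟩
  set z : EuclideanSpace ℝ T := p + EuclideanSpace.single i (y - p i) with hz
  have hzbox : z ∈ P.box T := by
    intro j
    by_cases hj : j = i
    · subst hj; simpa [hz] using hy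
    · simpa [hz, hj] using hp.1 j
  have h1 := hp.2 z hzbox
  have h2 : z - v = (p - v) + EuclideanSpace.single i (y - p i) := by rw [hz]; abel
  have h3 := norm_add_sq_real (p - v) (EuclideanSpace.single i (y - p i))
  rw [← h2, EuclideanSpace.inner_single_right, PiLp.norm_single] at h3
  have h4 : ‖p - v‖ ^ 2 ≤ ‖z - v‖ ^ 2 := by gcongr
  simp only [PiLp.sub_apply, Real.norm_eq_abs, sq_abs, conj_trivial] at h3 ⊢
  rw [← sq_le_sq]
  linarith

theorem projPoint_box_apply (T : Finset (Fin n)) (v : EuclideanSpace ℝ T) (i : T) :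
    projPoint (P.box T) v i = projPoint (P.X i) (v i) := by
  have h : projPoint (P.box T) v ∈ nearestPoints (P.box T) v := by
    rw [P.nearestPoints_box T v]; rfl
  exact eq_of_mem_nearestPoints (P.X_interval i) (P.mem_nearestPoints_of_box h i)
    (projPoint_mem_nearestPoints (P.X_closed i) ⟨0, P.X_zero i⟩ _)

variable (T : Finset (Fin n))

theorem F_proj (Y : PrimalDual n k m) (i : T) :
    P.F T Y (Sum.inr (Sum.inr (Sum.inl i))) =
      Y.x i - projPoint (P.X i) (Y.x i + Y.ν i) :=
  congrArg (fun r => Y.x i - r) (P.projPoint_box_apply T (subvec T Y.x + subvec T Y.ν) i)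

theorem F_compl (Y : PrimalDual n k m) (c : Fin k ⊕ Fin m) :
    P.F T Y (Sum.inr (Sum.inr (Sum.inr (Sum.inr c)))) =
      fischerBurmeister (P.slack c (xL Y)) (multL c Y) := by
  rcases c with i | i <;> rfl

/-- The parameters of a generalized Jacobian: slopes of the interval projections, and
subgradients of the Euclidean norm of the plane for the complementarity conditions. -/
abbrev Slopes (n k m : ℕ) : Type := (Fin n → ℝ) × (Fin k ⊕ Fin m → ℝ × ℝ)

/-- The slopes that are admissible at `Y`. -/
noncomputable def slopes (Y : PrimalDual n k m) : Set (Slopes n k m) :=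
  {θ | (∀ i, θ.1 i ∈ intervalSlopes (P.X i) (Y.x i + Y.ν i)) ∧
    ∀ c, θ.2 c ∈ normSlopes (P.slack c (xL Y)) (multL c Y)}

/-- The rows of the operator obtained by differentiating `F(·; T)` at `Y` with the slopes `θ` in
place of the derivatives of the nonsmooth functions. -/
noncomputable def jacRow (Y : PrimalDual n k m) (θ : Slopes n k m) :
    T ⊕ ↥(Tᶜ) ⊕ T ⊕ ↥(Tᶜ) ⊕ Fin k ⊕ Fin m → PrimalDual n k m →L[ℝ] ℝ :=
  Sum.elim (fun i : T => fderiv ℝ (fun Y => (P.gradL Y + νL Y) i) Y)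
    (Sum.elim (fun i : ↥(Tᶜ) => EuclideanSpace.proj i.1 ∘L xL)
    (Sum.elim (fun i : T => EuclideanSpace.proj i.1 ∘L xL -
      θ.1 i • (EuclideanSpace.proj i.1 ∘L (xL + νL)))
    (Sum.elim (fun i : ↥(Tᶜ) => EuclideanSpace.proj i.1 ∘L νL)
      (fun c => ((θ.2 c).1 - 1) • fderiv ℝ (fun Y => P.slack c (xL Y)) Y +
        ((θ.2 c).2 - 1) • multL c))))

/-- The operator with rows `jacRow`. -/
noncomputable def jac (Y : PrimalDual n k m) (θ : Slopes n k m) :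
    PrimalDual n k m →L[ℝ] EuclideanSpace ℝ (T ⊕ ↥(Tᶜ) ⊕ T ⊕ ↥(Tᶜ) ⊕ Fin k ⊕ Fin m) :=
  (PiLp.continuousLinearEquiv 2 ℝ _).symm.toContinuousLinearMap ∘L
    ContinuousLinearMap.pi (P.jacRow T Y θ)

theorem jac_apply (Y : PrimalDual n k m) (θ : Slopes n k m) (v : PrimalDual n k m)
    (j : T ⊕ ↥(Tᶜ) ⊕ T ⊕ ↥(Tᶜ) ⊕ Fin k ⊕ Fin m) : P.jac T Y θ v j = P.jacRow T Y θ j v := rfl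

theorem contDiff_stat (i : Fin n) :
    ContDiff ℝ 1 (fun Y : PrimalDual n k m => (P.gradL Y + νL Y) i) := by
  have h1 := P.contDiff_gradL
  have h2 : ContDiff ℝ 1 (fun Y : PrimalDual n k m => P.gradL Y + νL Y) :=
    h1.add νL.contDiff
  exact (EuclideanSpace.proj (𝕜 := ℝ) i).contDiff.comp h2

theorem contDiff_slack_comp (c : Fin k ⊕ Fin m) :
    ContDiff ℝ 1 (fun Y : PrimalDual n k m => P.slack c (xL Y)) :=
  (P.contDiff_slack c).comp xL.contDiff

theorem fderiv_stat_apply (Y v : PrimalDual n k m) (i : Fin n) :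
    fderiv ℝ (fun Y => (P.gradL Y + νL Y) i) Y v =
      (P.hessL Y v.x + ∑ c, multL c v • P.normal c Y.x + v.ν) i := by
  have h1 := ((P.contDiff_gradL.differentiable (by norm_num)) Y).hasFDerivAt.add
    (νL.hasFDerivAt (x := Y))
  have h2 := (EuclideanSpace.proj (𝕜 := ℝ) i).hasFDerivAt.comp Y h1
  rw [← P.fderiv_gradL_apply Y v]
  exact congrArg (fun L : PrimalDual n k m →L[ℝ] ℝ => L v) h2.fderiv

theorem fderiv_slack_apply (Y v : PrimalDual n k m) (c : Fin k ⊕ Fin m) :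
    fderiv ℝ (fun Y => P.slack c (xL Y)) Y v = -inner ℝ (P.normal c Y.x) v.x := by
  have h := (P.hasFDerivAt_slack c (xL Y)).comp Y (xL.hasFDerivAt (x := Y))
  exact congrArg (fun L : PrimalDual n k m →L[ℝ] ℝ => L v) h.fderiv

theorem continuous_jac :
    Continuous fun q : PrimalDual n k m × Slopes n k m => P.jac T q.1 q.2 := by
  refine continuous_clm_apply.2 fun v => ?_
  refine (PiLp.continuous_toLp 2 _).comp (continuous_pi fun j => ?_)
  change Continuous fun q : PrimalDual n k m × Slopes n k m => P.jacRow T q.1 q.2 j v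
  rcases j with i | i | i | i | c
  · have := (P.contDiff_stat i).continuous_fderiv (by norm_num)
    simp only [jacRow, Sum.elim_inl]
    fun_prop
  · simp only [jacRow, Sum.elim_inl, Sum.elim_inr]
    fun_prop
  · simp only [jacRow, Sum.elim_inl, Sum.elim_inr]
    fun_prop
  · simp only [jacRow, Sum.elim_inl, Sum.elim_inr]
    fun_prop
  · have := (P.contDiff_slack_comp c).continuous_fderiv (by norm_num)
    simp only [jacRow, Sum.elim_inr]
    fun_prop

theorem slopes_nonempty (Y : PrimalDual n k m) : (P.slopes Y).Nonempty := by
  choose t ht using fun i => intervalSlopes_nonempty (P.X i) (Y.x i + Y.ν i)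
  choose p hp using fun c => normSlopes_nonempty (P.slack c (xL Y)) (multL c Y)
  exact ⟨(t, p), ht, hp⟩

theorem isClosed_graph_slopes :
    IsClosed {q : PrimalDual n k m × Slopes n k m | q.2 ∈ P.slopes q.1} := by
  have h : {q : PrimalDual n k m × Slopes n k m | q.2 ∈ P.slopes q.1} =
      (⋂ i, (fun q : PrimalDual n k m × Slopes n k m =>
        (xL q.1 i + νL q.1 i, q.2.1 i)) ⁻¹' {r | r.2 ∈ intervalSlopes (P.X i) r.1}) ∩
      ⋂ c, (fun q : PrimalDual n k m × Slopes n k m =>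
        ((P.slack c (xL q.1), multL c q.1), q.2.2 c)) ⁻¹' {r | r.2 ∈ normSlopes r.1.1 r.1.2} := by
    ext q
    simp [slopes, xL_apply, νL_apply]
  rw [h]
  refine (isClosed_iInter fun i => ?_).inter (isClosed_iInter fun c => ?_)
  · exact (isClosed_graph_intervalSlopes (P.X_closed i)).preimage (by fun_prop)
  · have := (P.contDiff_slack c).continuous
    exact isClosed_graph_normSlopes.preimage (by fun_prop)

theorem exists_isCompact_slopes_subset :
    ∃ B : Set (Slopes n k m), IsCompact B ∧ ∀ Y, P.slopes Y ⊆ B := by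
  refine ⟨(univ.pi fun _ => Icc 0 1) ×ˢ (univ.pi fun _ => Icc (-1) 1 ×ˢ Icc (-1) 1),
    (isCompact_univ_pi fun _ => isCompact_Icc).prod
      (isCompact_univ_pi fun _ => isCompact_Icc.prod isCompact_Icc), ?_⟩
  rintro Y θ ⟨h1, h2⟩
  refine ⟨fun i _ => (h1 i).1, fun c _ => ?_⟩
  have := (h2 c).1
  refine ⟨⟨?_, ?_⟩, ⟨?_, ?_⟩⟩ <;> nlinarith

theorem finrank_primalDual_eq :
    Module.finrank ℝ (PrimalDual n k m) =
      Module.finrank ℝ (EuclideanSpace ℝ (T ⊕ ↥(Tᶜ) ⊕ T ⊕ ↥(Tᶜ) ⊕ Fin k ⊕ Fin m)) := by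
  have h : T.card + Tᶜ.card = n := by simp
  simp only [finrank_euclideanSpace, Fintype.card_sum, Fintype.card_coe, Fintype.card_fin]
  omega

theorem convex_image_jac (Y : PrimalDual n k m) : Convex ℝ (P.jac T Y '' P.slopes Y) := by
  rintro _ ⟨θ, ⟨h1, h2⟩, rfl⟩ _ ⟨θ', ⟨h1', h2'⟩, rfl⟩ α β hα hβ hαβ
  refine ⟨α • θ + β • θ', ⟨fun i => convex_intervalSlopes _ _ (h1 i) (h1' i) hα hβ hαβ,
    fun c => convex_normSlopes _ _ (h2 c) (h2' c) hα hβ hαβ⟩, ?_⟩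
  obtain rfl : β = 1 - α := by linarith
  ext v j
  simp only [jac_apply, add_apply, smul_apply,
    PiLp.add_apply, PiLp.smul_apply]
  rcases j with i | i | i | i | c <;> simp [jacRow] <;> ring

/-! ### Clarke Jacobian of the stationarity system -/

/-- If `x_i - π(x_i + ν_i)` is differentiable, then so is `π` at `x_i + ν_i`, as the line in
direction `ν_i` shows, and its derivative is an admissible slope. -/
theorem exists_slope_of_hasFDerivAt_proj {u : PrimalDual n k m} {L : PrimalDual n k m →L[ℝ] ℝ}
    (i : Fin n) (hL : HasFDerivAt (fun Y : PrimalDual n k m =>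
      Y.x i - projPoint (P.X i) (Y.x i + Y.ν i)) L u) :
    ∃ t ∈ intervalSlopes (P.X i) (u.x i + u.ν i),
      L = EuclideanSpace.proj i ∘L xL - t • (EuclideanSpace.proj i ∘L (xL + νL)) := by
  have hx : HasFDerivAt (fun Y : PrimalDual n k m => Y.x i) (EuclideanSpace.proj i ∘L xL) u :=
    (EuclideanSpace.proj (𝕜 := ℝ) i ∘L (xL (k := k) (m := m))).hasFDerivAt
  have hw : HasFDerivAt (fun Y : PrimalDual n k m => Y.x i + Y.ν i)
      (EuclideanSpace.proj i ∘L (xL + νL)) u :=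
    (EuclideanSpace.proj (𝕜 := ℝ) i ∘L (xL (k := k) (m := m) + νL)).hasFDerivAt
  have hπ : HasFDerivAt (fun Y : PrimalDual n k m => projPoint (P.X i) (Y.x i + Y.ν i))
      (EuclideanSpace.proj i ∘L xL - L) u :=
    (hx.sub hL).congr_of_eventuallyEq (Eventually.of_forall fun Y => (sub_sub_cancel _ _).symm)
  set e : PrimalDual n k m := EuclideanSpace.single (Sum.inr (Sum.inl i)) (1 : ℝ) with he
  have hline : HasDerivAt (fun s : ℝ => u + (s - (u.x i + u.ν i)) • e) e (u.x i + u.ν i) := by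
    simpa using
      (((hasDerivAt_id (u.x i + u.ν i)).sub_const (u.x i + u.ν i)).smul_const e).const_add u
  have hu : u + ((u.x i + u.ν i) - (u.x i + u.ν i)) • e = u := by simp
  have h1 : HasDerivAt (projPoint (P.X i))
      ((EuclideanSpace.proj i ∘L xL - L : PrimalDual n k m →L[ℝ] ℝ) e)
      (u.x i + u.ν i) := by
    refine (HasFDerivAt.comp_hasDerivAt (u.x i + u.ν i) (by rw [hu]; exact hπ)
      hline).congr_of_eventuallyEq (Eventually.of_forall fun s => ?_)
    have hex : ∀ s : ℝ, (u + s • e).x i = u.x i := fun s => by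
      simp [PrimalDual.x, he]
    have heν : ∀ s : ℝ, (u + s • e).ν i = u.ν i + s := fun s => by
      simp [PrimalDual.ν, he]
    simp only [Function.comp, hex, heν]
    congr 1
    ring
  refine ⟨_, mem_intervalSlopes_of_hasDerivAt (P.X_closed i) (P.X_interval i)
    ⟨0, P.X_zero i⟩ h1, ?_⟩
  have h2 := HasDerivAt.comp_hasFDerivAt (f := fun Y : PrimalDual n k m => Y.x i + Y.ν i) u h1 hw
  have h3 := hπ.unique h2
  rw [← h3]
  abel

/-- Where a complementarity residual is differentiable, its slack and its multiplier do not both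
vanish, and the chain rule applies. -/
theorem exists_slope_of_hasFDerivAt_compl {u : PrimalDual n k m} {L : PrimalDual n k m →L[ℝ] ℝ}
    (c : Fin k ⊕ Fin m) (hL : HasFDerivAt (fun Y : PrimalDual n k m =>
      fischerBurmeister (P.slack c (xL Y)) (multL c Y)) L u) :
    ∃ p ∈ normSlopes (P.slack c (xL u)) (multL c u),
      L = (p.1 - 1) • fderiv ℝ (fun Y => P.slack c (xL Y)) u + (p.2 - 1) • multL c := by
  have hpos := sqrt_pos_of_differentiableAt_fischerBurmeister
    (e := EuclideanSpace.single (Sum.inr (Sum.inr c)) (1 : ℝ)) hL.differentiableAt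
    (fun s => by
      congr 1
      ext i
      simp [xL_apply, PrimalDual.x])
    (fun s => by simp [multL])
  exact ⟨_, mem_normSlopes_div hpos, hL.unique (hasFDerivAt_fischerBurmeister_comp
    (((P.contDiff_slack_comp c).differentiable (by norm_num)) u).hasFDerivAt
    (multL c).hasFDerivAt hpos)⟩

theorem fderiv_F_mem {u : PrimalDual n k m} (hd : DifferentiableAt ℝ (P.F T) u) :
    fderiv ℝ (P.F T) u ∈ P.jac T u '' P.slopes u := by
  set L := fderiv ℝ (P.F T) u with hLdef
  have hcomp : ∀ j, HasFDerivAt (fun Y => P.F T Y j) (EuclideanSpace.proj j ∘L L) u := fun j =>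
    (EuclideanSpace.proj (𝕜 := ℝ) j).hasFDerivAt.comp u hd.hasFDerivAt
  obtain ⟨θ₀, hθ₀, -⟩ := P.slopes_nonempty u
  have hproj : ∀ i : Fin n, ∃ t ∈ intervalSlopes (P.X i) (u.x i + u.ν i), ∀ hi : i ∈ T,
      EuclideanSpace.proj (Sum.inr (Sum.inr (Sum.inl ⟨i, hi⟩))) ∘L L =
        EuclideanSpace.proj i ∘L xL - t • (EuclideanSpace.proj i ∘L (xL + νL)) := by
    intro i
    by_cases hi : i ∈ T
    · have h := hcomp (Sum.inr (Sum.inr (Sum.inl ⟨i, hi⟩)))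
      simp only [F_proj] at h
      obtain ⟨t, ht, h⟩ := P.exists_slope_of_hasFDerivAt_proj i h
      exact ⟨t, ht, fun _ => h⟩
    · exact ⟨θ₀.1 i, hθ₀ i, fun h => absurd h hi⟩
  choose t ht htL using hproj
  have hcompl : ∀ c : Fin k ⊕ Fin m, ∃ p ∈ normSlopes (P.slack c (xL u)) (multL c u),
      EuclideanSpace.proj (Sum.inr (Sum.inr (Sum.inr (Sum.inr c)))) ∘L L =
        (p.1 - 1) • fderiv ℝ (fun Y => P.slack c (xL Y)) u + (p.2 - 1) • multL c := by
    intro c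
    have h := hcomp (Sum.inr (Sum.inr (Sum.inr (Sum.inr c))))
    simp only [F_compl] at h
    exact P.exists_slope_of_hasFDerivAt_compl c h
  choose p hp hpL using hcompl
  refine ⟨(t, p), ⟨ht, hp⟩, ?_⟩
  ext v j
  rw [jac_apply]
  change _ = (EuclideanSpace.proj j ∘L L) v
  congr 1
  rcases j with i | i | i | i | c
  · exact (hcomp (Sum.inl i)).fderiv
  · exact (EuclideanSpace.proj (𝕜 := ℝ) i.1 ∘L xL).hasFDerivAt.unique (hcomp (Sum.inr (Sum.inl i)))
  · exact (htL i i.2).symm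
  · exact (EuclideanSpace.proj (𝕜 := ℝ) i.1 ∘L νL).hasFDerivAt.unique
      (hcomp (Sum.inr (Sum.inr (Sum.inr (Sum.inl i)))))
  · exact (hpL c).symm

theorem clarkeJacobian_F_subset (Y : PrimalDual n k m) :
    clarkeJacobian (P.F T) Y ⊆ P.jac T Y '' P.slopes Y := by
  obtain ⟨B, hB, hKB⟩ := P.exists_isCompact_slopes_subset
  exact clarkeJacobian_subset_image hB hKB P.isClosed_graph_slopes (P.continuous_jac T)
    (fun _ => P.fderiv_F_mem T) (P.convex_image_jac T Y)

/-- The remainder of the linearisation is estimated row by row: it vanishes for the linear rows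
and the projection rows, and is `o(‖Y - Y₀‖)` for the others. -/
theorem eventually_norm_F_sub_le (Y₀ : PrimalDual n k m) {δ : ℝ} (hδ : 0 < δ) :
    ∀ᶠ Y in 𝓝 Y₀, ∀ θ ∈ P.slopes Y,
      ‖P.F T Y - P.F T Y₀ - P.jac T Y θ (Y - Y₀)‖ ≤ δ * ‖Y - Y₀‖ := by
  set J := T ⊕ ↥(Tᶜ) ⊕ T ⊕ ↥(Tᶜ) ⊕ Fin k ⊕ Fin m
  set η := δ / (Fintype.card J + 1) with hη
  have hη0 : 0 < η := by positivity
  have hrow : ∀ j : J, ∀ᶠ Y in 𝓝 Y₀, ∀ θ ∈ P.slopes Y,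
      |P.F T Y j - P.F T Y₀ j - P.jacRow T Y θ j (Y - Y₀)| ≤ η * ‖Y - Y₀‖ := by
    rintro (i | i | i | i | c)
    · filter_upwards [(P.contDiff_stat i).eventually_norm_sub_fderiv_le Y₀ hη0] with Y h θ hθ
      exact h
    · refine Eventually.of_forall fun Y θ _ => ?_
      have : P.F T Y (Sum.inr (Sum.inl i)) - P.F T Y₀ (Sum.inr (Sum.inl i)) -
          P.jacRow T Y θ (Sum.inr (Sum.inl i)) (Y - Y₀) = 0 :=
        sub_eq_zero.2 rfl
      rw [this, abs_zero]
      positivity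
    · have hcont : Continuous fun Y : PrimalDual n k m => xL Y i + νL Y i := by fun_prop
      filter_upwards [hcont.continuousAt (x := Y₀) |>.eventually
        (eventually_projPoint_sub_eq (P.X_closed i) (P.X_interval i) ⟨0, P.X_zero i⟩ _)]
        with Y h θ hθ
      have h1 := h _ (hθ.1 i)
      have h2 : P.jacRow T Y θ (Sum.inr (Sum.inr (Sum.inl i))) (Y - Y₀) =
          (xL Y i - xL Y₀ i) - θ.1 i * ((xL Y i - xL Y₀ i) + (νL Y i - νL Y₀ i)) := by
        simp [jacRow]
        ring
      simp only [F_proj, h2]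
      simp only [xL_apply, νL_apply] at h1 ⊢
      have h3 : Y.x i - projPoint (P.X i) (Y.x i + Y.ν i) -
          (Y₀.x i - projPoint (P.X i) (Y₀.x i + Y₀.ν i)) -
          (Y.x i - Y₀.x i - θ.1 i * (Y.x i - Y₀.x i + (Y.ν i - Y₀.ν i))) = 0 := by
        linear_combination -h1
      rw [h3, abs_zero]
      positivity
    · refine Eventually.of_forall fun Y θ _ => ?_
      have : P.F T Y (Sum.inr (Sum.inr (Sum.inr (Sum.inl i)))) -
          P.F T Y₀ (Sum.inr (Sum.inr (Sum.inr (Sum.inl i)))) -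
          P.jacRow T Y θ (Sum.inr (Sum.inr (Sum.inr (Sum.inl i)))) (Y - Y₀) = 0 :=
        sub_eq_zero.2 rfl
      rw [this, abs_zero]
      positivity
    · filter_upwards [eventually_fischerBurmeister_comp_sub_le (P.contDiff_slack_comp c)
        (multL c).contDiff Y₀ hη0] with Y h θ hθ
      have h1 := h _ (hθ.2 c)
      rw [(multL c).fderiv] at h1
      simp only [F_compl]
      exact h1
  filter_upwards [eventually_all.2 hrow] with Y h θ hθ
  refine (EuclideanSpace.norm_le_sum_abs _).trans ?_
  calc ∑ j, |(P.F T Y - P.F T Y₀ - P.jac T Y θ (Y - Y₀)) j|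
      ≤ ∑ _j : J, η * ‖Y - Y₀‖ := Finset.sum_le_sum fun j _ => h j θ hθ
    _ = Fintype.card J * η * ‖Y - Y₀‖ := by simp [mul_assoc]
    _ ≤ δ * ‖Y - Y₀‖ := by
        gcongr
        rw [hη, mul_div_assoc', div_le_iff₀ (by positivity)]
        nlinarith

/-! ### Index sets of largest entries at a stationary point -/

theorem eventually_largestSets_subset (τ : ℝ) (Y₀ : PrimalDual n k m) :
    ∀ᶠ Y in 𝓝 Y₀, P.largestSets τ Y ⊆ P.largestSets τ Y₀ := by
  have hcont : ∀ i, Continuous fun Y : PrimalDual n k m =>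
      |(xL Y - τ • (P.gradL Y + νL Y)) i| := fun i => by
    have := P.contDiff_gradL.continuous
    fun_prop
  have h : ∀ T : Finset (Fin n), ∀ᶠ Y in 𝓝 Y₀, T ∈ P.largestSets τ Y → T ∈ P.largestSets τ Y₀ := by
    intro T
    by_cases hT : T ∈ P.largestSets τ Y₀
    · exact Eventually.of_forall fun _ _ => hT
    by_cases hcard : T.card = P.s
    · have : ∃ i ∈ T, ∃ j ∉ T, |(Y₀.x - τ • (P.gradL Y₀ + Y₀.ν)) i| <
          |(Y₀.x - τ • (P.gradL Y₀ + Y₀.ν)) j| := by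
        by_contra! hcon
        exact hT ⟨hcard, hcon⟩
      obtain ⟨i, hi, j, hj, hlt⟩ := this
      filter_upwards [(hcont i).continuousAt.eventually_lt (hcont j).continuousAt hlt] with Y hY hTY
      exact absurd (hTY.2 i hi j hj) (not_le.2 hY)
    · exact Eventually.of_forall fun Y hY => absurd hY.1 hcard
  filter_upwards [eventually_all.2 h] with Y hY T hT using hY T hT

theorem apply_eq_of_mem_nearestPoints_sparseSet {u x : EuclideanSpace ℝ (Fin n)}
    (hx : x ∈ nearestPoints P.sparseSet u) {i : Fin n} (hi : i ∈ supp x ∨ (supp x).card < P.s) :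
    x i = u i := by
  set z := x + EuclideanSpace.single i (u i - x i) with hz
  have hsub : supp z ⊆ insert i (supp x) := by
    intro j hj
    by_cases hji : j = i
    · simp [hji]
    · simpa [supp, hz, hji] using hj
  have hzs : z ∈ P.sparseSet := by
    rcases hi with hi | hi
    · rw [Finset.insert_eq_of_mem hi] at hsub
      exact (Finset.card_le_card hsub).trans hx.1
    · exact (Finset.card_le_card hsub).trans ((Finset.card_insert_le _ _).trans hi)
  have h1 := hx.2 z hzs
  have h2 : z - u = (x - u) + EuclideanSpace.single i (u i - x i) := by rw [hz]; abel
  have h3 := norm_add_sq_real (x - u) (EuclideanSpace.single i (u i - x i))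
  rw [← h2, EuclideanSpace.inner_single_right, PiLp.norm_single] at h3
  have h4 : ‖x - u‖ ^ 2 ≤ ‖z - u‖ ^ 2 := by gcongr
  simp only [PiLp.sub_apply, Real.norm_eq_abs, sq_abs, conj_trivial] at h3
  nlinarith [sq_nonneg (x i - u i)]

/-- If the projection of `u` onto the sparse set is the single point `x`, then every set of `s`
largest entries of `u` contains the support of `x`, and `x` agrees with `u` on it. -/
theorem supp_subset_of_nearestPoints_sparseSet {u x : EuclideanSpace ℝ (Fin n)}
    (hx : nearestPoints P.sparseSet u = {x}) {T : Finset (Fin n)} (hcard : T.card = P.s)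
    (hT : ∀ i ∈ T, ∀ j ∉ T, |u j| ≤ |u i|) : supp x ⊆ T ∧ ∀ i ∈ T, x i = u i := by
  have hmem : x ∈ nearestPoints P.sparseSet u := by rw [hx]; rfl
  have hagree := fun i => P.apply_eq_of_mem_nearestPoints_sparseSet hmem (i := i)
  have hsub : supp x ⊆ T := by
    intro j hj
    by_contra hjT
    have hxj : x j ≠ 0 := by simpa [supp] using hj
    obtain ⟨i, hiT, hi⟩ : ∃ i ∈ T, i ∉ supp x := by
      by_contra! hcon
      have hlt : T.card < (supp x).card :=
        Finset.card_lt_card ⟨hcon, fun h => hjT (h hj)⟩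
      exact absurd hmem.1 (by rw [sparseSet, mem_ofPred_eq]; omega)
    have hxi : x i = 0 := by simpa [supp] using hi
    have hij : i ≠ j := fun h => hi (h ▸ hj)
    have huj : x j = u j := hagree j (Or.inl hj)
    have hle := sq_le_sq.2 (hT i hiT j hjT)
    -- exchanging the entries `j` and `i` yields another nearest point
    set w : EuclideanSpace ℝ (Fin n) :=
      EuclideanSpace.single j (-u j) + EuclideanSpace.single i (u i) with hw
    have hwj : (x + w) j = 0 := by simp [hw, huj, hij.symm]
    have hsupp : supp (x + w) ⊆ insert i ((supp x).erase j) := by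
      intro l hl
      by_cases hli : l = i
      · simp [hli]
      by_cases hlj : l = j
      · subst hlj; exact absurd hwj (Finset.mem_filter.1 hl).2
      · simpa [supp, hw, hli, hlj] using hl
    have hsparse : x + w ∈ P.sparseSet := by
      have h1 := Finset.card_le_card hsupp
      have h2 := Finset.card_insert_le i ((supp x).erase j)
      have h3 := Finset.card_erase_add_one hj
      have h4 : (supp x).card ≤ P.s := hmem.1
      exact (h1.trans h2).trans (by omega)
    have hnorm : ‖x + w - u‖ ^ 2 = ‖x - u‖ ^ 2 + (u j ^ 2 - u i ^ 2) := by
      have h2 : x + w - u = (x - u) + w := by abel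
      rw [h2, norm_add_sq_real, hw, inner_add_right, norm_add_sq_real]
      simp only [EuclideanSpace.inner_single_right, PiLp.norm_single, PiLp.sub_apply,
        conj_trivial, hxi, huj, Real.norm_eq_abs, sq_abs, PiLp.single_apply]
      rw [if_neg hij]
      ring
    have hnear : x + w ∈ nearestPoints P.sparseSet u := by
      refine ⟨hsparse, fun z hz => ?_⟩
      have h1 : ‖x + w - u‖ ≤ ‖x - u‖ := by
        refine le_of_sq_le_sq ?_ (norm_nonneg _)
        linarith
      exact h1.trans (hmem.2 z hz)
    rw [hx, mem_singleton_iff] at hnear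
    rw [hnear] at hwj
    exact hxj hwj
  refine ⟨hsub, fun i hi => hagree i ?_⟩
  have h4 : (supp x).card ≤ P.s := hmem.1
  rcases h4.eq_or_lt with h | h
  · left
    rw [Finset.eq_of_subset_of_card_le hsub (by omega)]
    exact hi
  · exact Or.inr h

/-! ### Residual and nonsingularity at a stationary point -/

/-- A pair of multiplier directions that balance on the support vanishes, if they live on the
active constraints only. -/
theorem eq_zero_of_restrictedLICQ {Y : PrimalDual n k m} (hL : P.RestrictedLICQ Y.x)
    (hcard : T.card = P.s) (hsub : supp Y.x ⊆ T) {y : Fin k ⊕ Fin m → ℝ} {ω : Fin n → ℝ}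
    (hy : ∀ c, P.slack c (xL Y) ≠ 0 → y c = 0)
    (hω : ∀ i, ¬(i ∈ T ∧ Y.x i ∈ frontier (P.X i)) → ω i = 0)
    (hbal : ∀ i ∈ supp Y.x, ∑ c, y c * P.normal c Y.x i + ω i = 0) : y = 0 ∧ ω = 0 := by
  classical
  have hli := Fintype.linearIndependent_iff.1 (hL.2 T ⟨hcard, hsub⟩)
    (Sum.elim (fun i => y (Sum.inl i.1)) (Sum.elim (fun i => y (Sum.inr i.1)) fun i => ω i.1)) ?_
  · refine ⟨funext fun c => ?_, funext fun i => ?_⟩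
    · by_cases hc : P.slack c (xL Y) = 0
      · rcases c with i | i
        · exact hli (Sum.inl ⟨i, neg_eq_zero.1 hc⟩)
        · exact hli (Sum.inr (Sum.inl ⟨i, (sub_eq_zero.1 hc).symm⟩))
      · exact hy c hc
    · by_cases hi : i ∈ T ∧ Y.x i ∈ frontier (P.X i)
      · exact hli (Sum.inr (Sum.inr ⟨i, hi⟩))
      · exact hω i hi
  · ext j
    have hj := hbal j j.2
    rw [Fintype.sum_sum_type] at hj
    have hsum : ∀ {ι : Type} [Fintype ι] (p : ι → Prop) [Fintype {i // p i}] (g : ι → ℝ),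
        (∀ i, ¬p i → g i = 0) → ∑ i : {i // p i}, g i.1 = ∑ i, g i := by
      intro ι _ p _ g hg
      rw [← Finset.sum_subset (Finset.subset_univ (Finset.univ.filter p))
        (fun i _ hi => hg i (by simpa using hi))]
      exact (Finset.sum_subtype (Finset.univ.filter p) (by simp) g).symm
    have e1 := hsum (fun i : Fin k => P.f i.succ Y.x = 0)
      (fun i => y (Sum.inl i) * P.normal (Sum.inl i) Y.x j)
      (fun i hi => by rw [hy (Sum.inl i) (fun h => hi (neg_eq_zero.1 h)), zero_mul])
    have e2 := hsum (fun i : Fin m => inner ℝ (P.a i) Y.x = P.b i)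
      (fun i => y (Sum.inr i) * P.normal (Sum.inr i) Y.x j)
      (fun i hi => by rw [hy (Sum.inr i) (fun h => hi (sub_eq_zero.1 h).symm), zero_mul])
    have e3 := hsum (fun i : Fin n => i ∈ T ∧ Y.x i ∈ frontier (P.X i))
      (fun i => ω i * (EuclideanSpace.single i (1 : ℝ) : EuclideanSpace ℝ (Fin n)) j)
      (fun i hi => by rw [hω i hi, zero_mul])
    have e4 : ∑ i, ω i * (EuclideanSpace.single i (1 : ℝ) : EuclideanSpace ℝ (Fin n)) j = ω j := by
      simp [PiLp.single_apply]
    rw [e4] at e3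
    rw [← e1, ← e2, ← e3] at hj
    rw [Fintype.sum_sum_type, Fintype.sum_sum_type]
    simp only [PiLp.add_apply, PiLp.zero_apply, Sum.elim_inl, Sum.elim_inr, WithLp.ofLp_sum,
      Finset.sum_apply, PiLp.smul_apply, smul_eq_mul, gradient_f]
    rw [← add_assoc]
    exact hj

namespace IsPStationary

variable {P T} {τ : ℝ} {Y : PrimalDual n k m}

theorem supp_subset (h : P.IsPStationary τ Y) (hT : T ∈ P.largestSets τ Y) : supp Y.x ⊆ T :=
  (P.supp_subset_of_nearestPoints_sparseSet h.1 hT.1 hT.2).1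

theorem stat_eq_zero (h : P.IsPStationary τ Y) (hτ : 0 < τ) (hT : T ∈ P.largestSets τ Y)
    {i : Fin n} (hi : i ∈ T) : (P.gradL Y + Y.ν) i = 0 := by
  have := (P.supp_subset_of_nearestPoints_sparseSet h.1 hT.1 hT.2).2 i hi
  rw [PiLp.sub_apply, PiLp.smul_apply, smul_eq_mul] at this
  have h2 : τ * (P.gradL Y + Y.ν) i = 0 := by linarith
  exact (mul_eq_zero.1 h2).resolve_left hτ.ne'

theorem mem_nearestPoints (h : P.IsPStationary τ Y) (i : Fin n) :
    Y.x i ∈ nearestPoints (P.X i) (Y.x i + Y.ν i) := by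
  by_cases hi : i ∈ supp Y.x
  · have hmem : subvec (supp Y.x) Y.x ∈ nearestPoints (P.box (supp Y.x))
        (subvec (supp Y.x) Y.x + subvec (supp Y.x) Y.ν) := by rw [h.2.1]; rfl
    exact P.mem_nearestPoints_of_box hmem ⟨i, hi⟩
  · have h0 : Y.x i = 0 := by simpa [supp] using hi
    rw [h.2.2.1 i hi, h0]
    exact ⟨P.X_zero i, fun y _ => by simp⟩

theorem complementarity (h : P.IsPStationary τ Y) (c : Fin k ⊕ Fin m) :
    0 ≤ P.slack c (xL Y) ∧ 0 ≤ multL c Y ∧ P.slack c (xL Y) * multL c Y = 0 := by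
  obtain ⟨-, -, -, hf, hA, hlam, hsum⟩ := h
  rcases c with i | i
  · obtain ⟨h1, h2, h3⟩ := hf i
    simp only [slack, Sum.elim_inl, multL_inl, xL_apply]
    exact ⟨by linarith, h2, by linarith⟩
  · have h0 := (Finset.sum_eq_zero_iff_of_nonpos fun i _ =>
      mul_nonpos_of_nonneg_of_nonpos (hlam i) (hA i)).1 hsum i (Finset.mem_univ i)
    have h1 := hA i
    simp only [slack, Sum.elim_inr, multL_inr, xL_apply]
    exact ⟨by linarith, hlam i, by linarith⟩

theorem F_eq_zero (h : P.IsPStationary τ Y) (hτ : 0 < τ) (hT : T ∈ P.largestSets τ Y) :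
    P.F T Y = 0 := by
  have hsub := h.supp_subset hT
  have hout : ∀ i : ↥(Tᶜ), i.1 ∉ supp Y.x := fun i hi => Finset.mem_compl.1 i.2 (hsub hi)
  ext j
  rcases j with i | i | i | i | c
  · exact h.stat_eq_zero hτ hT i.2
  · have h0 : Y.x i = 0 := by simpa [supp] using hout i
    exact h0
  · rw [F_proj, ← eq_of_mem_nearestPoints (P.X_interval i) (h.mem_nearestPoints i)
      (projPoint_mem_nearestPoints (P.X_closed i) ⟨0, P.X_zero i⟩ _), sub_self]
    rfl
  · exact h.2.2.1 i (hout i)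
  · obtain ⟨h1, h2, h3⟩ := h.complementarity c
    rw [F_compl]
    rcases mul_eq_zero.1 h3 with h3 | h3
    · simp [fischerBurmeister, h3, Real.sqrt_sq h2]
    · simp [fischerBurmeister, h3, Real.sqrt_sq h1]

/-- Every admissible linearisation at a P-stationary point is nonsingular. For `v` in the kernel,
the complementarity rows make all products of primal with multiplier directions nonnegative, so
the stationarity rows force `⟨v_x, ∇²L v_x⟩ ≤ 0` on the cone of the second-order condition, hence
`v_x = 0`; the multiplier directions then balance among active constraints. -/
theorem injective_jac (h : P.IsPStationary τ Y) (hL : P.RestrictedLICQ Y.x)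
    (hT : T ∈ P.largestSets τ Y) (hS : P.StrongSecondOrder Y T) {θ : Slopes n k m}
    (hθ : θ ∈ P.slopes Y) : Function.Injective (P.jac T Y θ) := by
  refine (injective_iff_map_eq_zero _).2 fun v hv => ?_
  have hrow : ∀ j, P.jacRow T Y θ j v = 0 := fun j => by rw [← jac_apply, hv]; rfl
  have hsub := h.supp_subset hT
  obtain ⟨t, p⟩ := θ
  obtain ⟨ht, hp⟩ := hθ
  simp only at ht hp
  have hstat : ∀ i ∈ T, (P.hessL Y v.x + ∑ c, multL c v • P.normal c Y.x + v.ν) i = 0 :=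
    fun i hi => by rw [← P.fderiv_stat_apply]; exact hrow (Sum.inl ⟨i, hi⟩)
  have hx0 : ∀ i ∉ T, v.x i = 0 := fun i hi =>
    hrow (Sum.inr (Sum.inl ⟨i, Finset.mem_compl.2 hi⟩))
  have hν0 : ∀ i ∉ T, v.ν i = 0 := fun i hi =>
    hrow (Sum.inr (Sum.inr (Sum.inr (Sum.inl ⟨i, Finset.mem_compl.2 hi⟩))))
  have hproj : ∀ i ∈ T, (1 - t i) * v.x i = t i * v.ν i := fun i hi => by
    have h1 : v.x i - t i * (v.x i + v.ν i) = 0 :=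
      hrow (Sum.inr (Sum.inr (Sum.inl ⟨i, hi⟩)))
    linear_combination h1
  have hcompl : ∀ c, (1 - (p c).1) * inner ℝ (P.normal c Y.x) v.x =
      (1 - (p c).2) * multL c v := fun c => by
    have h1 : ((p c).1 - 1) * fderiv ℝ (fun Y => P.slack c (xL Y)) Y v +
        ((p c).2 - 1) * multL c v = 0 := hrow (Sum.inr (Sum.inr (Sum.inr (Sum.inr c))))
    rw [fderiv_slack_apply] at h1
    linear_combination h1
  have hsignν : ∀ i, 0 ≤ v.x i * v.ν i := by
    intro i
    by_cases hi : i ∈ T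
    · obtain ⟨h1, h2⟩ := (ht i).1
      exact mul_nonneg_of_weighted_eq (sub_nonneg.2 h2) h1 (by linarith) (hproj i hi)
    · rw [hx0 i hi, zero_mul]
  have hsignc : ∀ c, 0 ≤ inner ℝ (P.normal c Y.x) v.x * multL c v := by
    intro c
    have h1 := (hp c).1
    exact mul_nonneg_of_weighted_eq (by nlinarith) (by nlinarith)
      (by nlinarith [sq_nonneg ((p c).1 - 1), sq_nonneg ((p c).2 - 1)]) (hcompl c)
  -- a nonzero `ν_i` means that `x_i + ν_i` lies outside `X_i`
  have hout : ∀ i, Y.ν i ≠ 0 → Y.x i + Y.ν i ∉ P.X i := fun i hi hmem => hi (by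
    linarith [eq_of_mem_nearestPoints_of_mem (h.mem_nearestPoints i) hmem])
  have hactive : ∀ c, 0 < multL c Y → P.slack c (xL Y) = 0 →
      inner ℝ (P.normal c Y.x) v.x = 0 := by
    intro c h1 h2
    obtain ⟨-, h3, h4⟩ := hp c
    rw [h2, zero_pow two_ne_zero, zero_add, Real.sqrt_sq h1.le] at h3 h4
    have h5 : (p c).1 = 0 := (mul_eq_zero.1 h3).resolve_left h1.ne'
    have h6 : (p c).2 = 1 := mul_left_cancel₀ h1.ne' (h4.trans (mul_one _).symm)
    have h7 := hcompl c
    rw [h5, h6] at h7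
    linarith
  have hcone : v.x ∈ P.coneQ Y T := by
    refine ⟨fun i h1 h2 => ?_, fun i h1 h2 => ?_, fun i hi h1 _ => ?_⟩
    · rw [gradient_f]
      exact hactive (Sum.inl i) h1 (neg_eq_zero.2 h2)
    · exact hactive (Sum.inr i) h1 (sub_eq_zero.2 h2.symm)
    · have h2 := hproj i hi
      rw [(ht i).2.2 (hout i h1)] at h2
      linarith
  have hquad : inner ℝ v.x (P.hessL Y v.x) ≤ 0 := by
    have h1 : inner ℝ v.x (P.hessL Y v.x + ∑ c, multL c v • P.normal c Y.x + v.ν) = 0 := by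
      rw [PiLp.inner_apply]
      refine Finset.sum_eq_zero fun i _ => ?_
      by_cases hi : i ∈ T
      · rw [hstat i hi, inner_zero_right]
      · rw [hx0 i hi, inner_zero_left]
    have h2 : 0 ≤ inner ℝ v.x v.ν := by
      rw [PiLp.inner_apply]
      refine Finset.sum_nonneg fun i _ => ?_
      simpa [mul_comm] using hsignν i
    have h3 : 0 ≤ inner ℝ v.x (∑ c, multL c v • P.normal c Y.x) := by
      rw [inner_sum]
      refine Finset.sum_nonneg fun c _ => ?_
      rw [inner_smul_right, real_inner_comm, mul_comm]
      exact hsignc c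
    rw [inner_add_right, inner_add_right] at h1
    linarith
  have hvx : v.x = 0 := by
    by_contra hne
    exact absurd (hS v.x hcone hne) (not_lt.2 hquad)
  have hzero := P.eq_zero_of_restrictedLICQ T (y := fun c => multL c v) (ω := fun i => v.ν i) hL
    hT.1 hsub ?_ ?_ ?_
  · refine eq_zero_of_blocks hvx ?_ (fun c => congrFun hzero.1 c)
    ext i
    exact congrFun hzero.2 i
  · intro c hc
    obtain ⟨h1, h2, h3⟩ := h.complementarity c
    have h4 : multL c Y = 0 := (mul_eq_zero.1 h3).resolve_left hc
    have h5 := (hp c).2.2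
    rw [h4, zero_pow two_ne_zero, add_zero, Real.sqrt_sq h1] at h5
    have h6 : (p c).2 = 0 := (mul_eq_zero.1 h5).resolve_left hc
    have h7 := hcompl c
    rw [h6, hvx, inner_zero_right] at h7
    linarith
  · intro i hi
    by_cases hiT : i ∈ T
    · have hint : Y.x i ∈ interior (P.X i) := by
        by_contra hcon
        exact hi ⟨hiT, subset_closure (h.mem_nearestPoints i).1, hcon⟩
      have h1 := eq_of_mem_nearestPoints_of_mem_interior (P.X_interval i)
        (h.mem_nearestPoints i) hint
      have h2 := hproj i hiT
      rw [(ht i).2.1 (by rw [h1]; exact hint), hvx] at h2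
      linarith
    · exact hν0 i hiT
  · intro i hi
    have h1 := hstat i (hsub hi)
    rw [hvx, map_zero, zero_add] at h1
    simpa using h1

end IsPStationary

end SQCQP

theorem mainTheorem4 {n k m : ℕ} (P : SQCQP n k m) (τ : ℝ) (hτ : 0 < τ)
    (Ystar : PrimalDual n k m) (hstat : P.IsPStationary τ Ystar)
    (hLICQ : P.RestrictedLICQ Ystar.x)
    (hSOC : ∀ T ∈ P.largestSets τ Ystar, P.StrongSecondOrder Ystar T)
    (ε : ℝ) (hε0 : 0 < ε) (hε1 : ε < 1) :
    ∃ N ∈ 𝓝 Ystar, ∀ Y ∈ N, Y.x ∈ P.sparseSet →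
      ∀ T ∈ P.largestSets τ Y, ∀ W ∈ clarkeJacobian (P.F T) Y,
        W.IsInvertible ∧
          ‖P.F T (Y - W.inverse (P.F T Y))‖ ≤ ε * ‖P.F T Y‖ := by
  have hT : ∀ T : Finset (Fin n), ∀ᶠ Y in 𝓝 Ystar, T ∈ P.largestSets τ Ystar →
      ∀ W ∈ clarkeJacobian (P.F T) Y,
        W.IsInvertible ∧ ‖P.F T (Y - W.inverse (P.F T Y))‖ ≤ ε * ‖P.F T Y‖ := by
    intro T
    by_cases hT : T ∈ P.largestSets τ Ystar
    · obtain ⟨B, hB, hKB⟩ := P.exists_isCompact_slopes_subset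
      have hbd := exists_eventually_bounds hB hKB P.isClosed_graph_slopes (P.continuous_jac T)
        (fun θ hθ => hstat.injective_jac hLICQ hT (hSOC T hT) hθ)
      filter_upwards [eventually_norm_newton_le (SQCQP.finrank_primalDual_eq T) P.slopes_nonempty
        (hstat.F_eq_zero hτ hT) hbd (fun δ hδ => P.eventually_norm_F_sub_le T Ystar hδ) hε0]
        with Y hY _ W hW
      exact hY W (P.clarkeJacobian_F_subset T Y hW)
    · exact Eventually.of_forall fun _ h => absurd h hT
  refine ⟨_, (P.eventually_largestSets_subset τ Ystar).and (eventually_all.2 hT), ?_⟩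
  rintro Y ⟨h1, h2⟩ - T hTY
  exact h2 T (h1 hTY)
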